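/- Let $k$ be a perfect field of characteristic $2$ (for example a finite field), and let $X$ be a smooth, projective, geometrically irreducible curve over $k$ with function field $k(X)$. Let $R_X$ be the set of finite separable nonconstant $k$-morphisms $X\to\mathbb{P}^1_k$. By pulling back a fixed coordinate of $\mathbb{P}^1_k$, identify $R_X$ with the set of $f\in k(X)$ whose differential $df\in\Omega_{k(X)/k}$ is nonzero. Let $\Gamma=\mathrm{PGL}_2(k(X))$ act on $R_X$ by $$\begin{pmatrix} a&b\\ c&d\end{pmatrix}(f)=\frac{a^4f+b^4}{c^4f+d^4}.$$ For a closed point $x$ of $X$, let $v_x$ be the corresponding normalized valuation of $k(X)$. The ramification index of $f\in R_X$ at $x$ is the integer $e\ge 1$ with $\mathfrak{m}_{\mathbb{P}^1_k,f(x)}\mathcal{O}_{X,x}=\mathfrak{m}_{X,x}^{e}$. Call $f$ tame if its ramification index is odd at every closed point of $X$. Call $f$ pseudotame if for every closed point $x$ of $X$, taking a uniformizer $t$ of $\mathbb{P}^1_k$ at $f(x)$, there exists $h\in k(X)$ such that $v_x(f^*t+h^4)$ is odd (this does not depend on the choice of $t$). If $f\in R_X$ is pseudotame, then there exists $g\in\Gamma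 f$ which is tame (and $g\in R_X$). In particular, $X$ admits a tame morphism in $R_X$ if and only if it admits a pseudotame morphism in $R_X$. -/

import Mathlib

open AlgebraicGeometry CategoryTheory

universe u

namespace PseudotameCurve

noncomputable section

/-! Throughout, `π : X ⟶ Spec k` is an integral scheme over a field, with function field
`k(X) = X.functionField`. For `x : X` the local ring `𝒪_{X,x}` is `X.presheaf.stalk x`, which
Mathlib makes a local ring with an algebra map to `k(X)`. -/

variable {k : Type u} [Field k] {X : Scheme.{u}} [IsIntegral X] (π : X ⟶ Spec (.of k))

/-- The structure map `k → Γ(X, 𝒪_X) → k(X)`. -/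
def constantMap : k →+* X.functionField :=
  ((Scheme.ΓSpecIso (.of k)).inv ≫ π.appTop ≫
    X.presheaf.germ ⊤ (genericPoint X) trivial).hom

/-- `k(X)` as a `k`-algebra. -/
abbrev functionFieldAlgebra : Algebra k X.functionField :=
  (constantMap π).toAlgebra

/-- `R_X`: the finite separable nonconstant `k`-morphisms `X ⟶ ℙ¹_k`, each identified with the
pullback of the fixed coordinate of `ℙ¹_k`. These pullbacks are exactly the elements `f` of `k(X)`
whose differential `df ∈ Ω_{k(X)/k}` is nonzero. -/
def separableMorphisms : Set X.functionField :=
  letI := functionFieldAlgebra π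
  {f | KaehlerDifferential.D k X.functionField f ≠ 0}

/-- The subfield `k(f)` of `k(X)`, which is the image of the function field of `ℙ¹_k` under
pullback along `f` when `f ∈ R_X`. -/
def adjoinFunction (f : X.functionField) : Subfield X.functionField :=
  letI := functionFieldAlgebra π
  (IntermediateField.adjoin k {f}).toSubfield

/-- The local ring of `ℙ¹_k` at the point `f(x)`, embedded in `k(X)` by pullback along `f`.
For `f ∈ R_X` and a closed point `x` of a smooth curve, pullback along `f` identifies the function
field of `ℙ¹_k` with `k(f)`, and the discrete valuation ring `𝒪_{ℙ¹,f(x)}` with the subring of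
`k(f)` of the functions that are regular at `x`. -/
def localRingAtImage (f : X.functionField) (x : X) : Subring X.functionField :=
  (adjoinFunction π f).toSubring ⊓ (algebraMap (X.presheaf.stalk x) X.functionField).range

/-- `t = f^* t₀` for some uniformizer `t₀` of `ℙ¹_k` at `f(x)`: the element `t` of the local ring at
`f(x)` generates its maximal ideal, which is the set of nonunits. -/
def IsUniformizerAtImage (f : X.functionField) (x : X) (t : X.functionField) : Prop :=
  ∃ ht : t ∈ localRingAtImage π f x,
    ∀ a : localRingAtImage π f x, a ∈ nonunits (localRingAtImage π f x) ↔ ⟨t, ht⟩ ∣ a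

/-- `v_x(a) = n`, where `v_x` is the valuation of `k(X)` at `x`: the element `a` is a unit of
`𝒪_{X,x}` times the `n`-th power of a generator of the maximal ideal. This never holds for `a = 0`
if `x` is a closed point of a smooth curve. -/
def HasOrder (x : X) (a : X.functionField) (n : ℤ) : Prop :=
  ∃ ϖ w : X.presheaf.stalk x,
    IsLocalRing.maximalIdeal (X.presheaf.stalk x) = Ideal.span {ϖ} ∧ IsUnit w ∧
      a = algebraMap _ X.functionField w * algebraMap _ X.functionField ϖ ^ n

/-- The ramification index of `f` at `x` is `e`: the ideal of `𝒪_{X,x}` generated by the maximal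
ideal of the local ring of `ℙ¹_k` at `f(x)` is the `e`-th power of the maximal ideal. -/
def HasRamificationIndex (f : X.functionField) (x : X) (e : ℕ) : Prop :=
  Ideal.span {s : X.presheaf.stalk x | ∃ a : localRingAtImage π f x,
      a ∈ nonunits (localRingAtImage π f x) ∧ algebraMap _ X.functionField s = a} =
    IsLocalRing.maximalIdeal (X.presheaf.stalk x) ^ e

/-- `f` is tame (in characteristic `2`): at every closed point of `X`, the ramification index
is not divisible by `2`. -/
def IsTame (f : X.functionField) : Prop :=
  ∀ x : X, IsClosed {x} → ∃ e : ℕ, HasRamificationIndex π f x e ∧ ¬ 2 ∣ e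

/-- `f` is pseudotame at `x`: for a uniformizer `t₀` of `ℙ¹_k` at `f(x)`, there is `h ∈ k(X)`
such that `v_x(f^* t₀ + h⁴)` is odd. -/
def IsPseudotameAt (f : X.functionField) (x : X) : Prop :=
  ∃ t : X.functionField, IsUniformizerAtImage π f x t ∧
    ∃ (h : X.functionField) (n : ℤ), HasOrder x (t + h ^ 4) n ∧ Odd n

/-- `f` is pseudotame: it is so at every closed point of `X`. -/
def IsPseudotame (f : X.functionField) : Prop :=
  ∀ x : X, IsClosed {x} → IsPseudotameAt π f x

end

end PseudotameCurve

namespace PseudotameCurve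

noncomputable section

variable {K : Type u} [Field K]

/-- The transformation of `K` by a matrix `(a, b; c, d)` in `GL₂(K)`, which sends `f` to
`(a⁴ f + b⁴) / (c⁴ f + d⁴)`. Scalar matrices act trivially. -/
def gammaAct (γ : Matrix.GeneralLinearGroup (Fin 2) K) (f : K) : K :=
  (γ.val 0 0 ^ 4 * f + γ.val 0 1 ^ 4) / (γ.val 1 0 ^ 4 * f + γ.val 1 1 ^ 4)

/-- The orbit `Γ f` of `f` under `Γ = PGL₂(K)`. -/
def gammaOrbit (f : K) : Set K :=
  {g | ∃ γ : Matrix.GeneralLinearGroup (Fin 2) K, g = gammaAct γ f}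

end

end PseudotameCurve

namespace PseudotameCurve

open Polynomial WithZero
open scoped IntermediateField

/-! ### Places of a function field -/

/-! Write F = f + h⁴ and g = F³ + d⁴. Since g = (F⁴ + d⁴F)/F and F⁴ is a fourth power, g lies in the
orbit of f as soon as F ≠ 0. The whole problem is to choose h and d in K = k(X) so that g is tame at
every closed point, each point being handled through its valuation.

Two local facts drive the choice. First, pseudotameness, which concerns a uniformizer of k(f),
passes to f itself: at each point some f + t⁴ has odd order (`exists_not_isSquare_add_pow_four`).
Second, g is tame wherever it has odd order, and also wherever g and u are regular and g + u⁴ has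
order 1 or 3 (`tameAt_of_add_pow_four`). The bound 3 occurs because k is perfect: a polynomial in u⁴
is a fourth power, so if it vanishes at the point then it has order at least 4.

After adding a fourth power, f has odd order at its original poles. The points then fall into three
kinds. (1) Off the poles, f is a uniformizer up to a fourth power at all but finitely many points,
because df ≠ 0. There any regular h and d make g tame. (2) At the finitely many other points off the
poles, h approximates t and d vanishes to high order, so F³ dominates g and has odd order. (3) At
the poles, h has a very large pole and d⁴ cancels h¹² up to an error bounded independently of h, so
fh⁸ dominates g. Strong approximation provides h. The finiteness of K over k(f) provides d, through
`exists_bound`, a weak substitute for Riemann–Roch.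

Conversely a tame f is pseudotame, with zero as the added fourth power. -/

/-- A discrete valuation of `K`, trivial on `k`, whose residue field is algebraic over `k` and
consists of fourth powers. -/
structure IsPlace (k : Type*) {K : Type*} [Field k] [Field K] [Algebra k K]
    (w : Valuation K ℤᵐ⁰) : Prop where
  exists_uniformizer : ∃ ϖ, w ϖ = exp (-1)
  map_algebraMap_le_one : ∀ c : k, w (algebraMap k K c) ≤ 1
  exists_irreducible : ∀ a, w a ≤ 1 → ∃ P : k[X], Irreducible P ∧ w (aeval a P) < 1
  exists_pow_four : ∀ a, w a ≤ 1 → ∃ u, w u ≤ 1 ∧ w (a + u ^ 4) < 1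

/-- Odd order is expressed throughout as `¬ IsSquare (w a)`. This ignores nonzero fourth-power
factors and excludes `a = 0`, because `0` is a square. -/
theorem isSquare_exp_iff (n : ℤ) : IsSquare (exp n : ℤᵐ⁰) ↔ Even n := by
  constructor
  · rintro ⟨y, hy⟩
    have hy0 : y ≠ 0 := by
      rintro rfl
      simp at hy
    refine ⟨log y, ?_⟩
    rw [← log_mul hy0 hy0, ← hy, log_exp]
  · rintro ⟨m, rfl⟩
    exact ⟨exp m, exp_add m m⟩

theorem exists_exp_eq_of_not_isSquare {x : ℤᵐ⁰} (hx : ¬ IsSquare x) :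
    ∃ n : ℤ, Odd n ∧ x = exp n := by
  have hx0 : x ≠ 0 := by
    rintro rfl
    exact hx ⟨0, by simp⟩
  refine ⟨log x, ?_, (exp_log hx0).symm⟩
  rw [← Int.not_even_iff_odd, ← isSquare_exp_iff, exp_log hx0]
  exact hx

theorem isSquare_pow_four (x : ℤᵐ⁰) : IsSquare (x ^ 4) := ⟨x ^ 2, by rw [← pow_add]⟩

theorem isSquare_mul_pow_four_iff {x y : ℤᵐ⁰} (hy : y ≠ 0) : IsSquare (x * y ^ 4) ↔ IsSquare x := by
  constructor
  · rintro ⟨z, hz⟩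
    refine ⟨z / y ^ 2, ?_⟩
    rw [div_mul_div_comm, ← hz, ← pow_add]
    exact (mul_div_cancel_right₀ _ (pow_ne_zero _ hy)).symm
  · rintro ⟨z, rfl⟩
    exact ⟨z * y ^ 2, by rw [mul_mul_mul_comm, ← pow_add]⟩

theorem le_exp_sub_one_of_lt {x : ℤᵐ⁰} {n : ℤ} (h : x < exp n) : x ≤ exp (n - 1) := by
  rcases eq_or_ne x 0 with rfl | hx
  · exact zero_le
  · rw [← exp_log hx] at h ⊢
    rw [exp_lt_exp] at h
    rw [exp_le_exp]
    omega

theorem add_pow_four {R : Type*} [CommRing R] [CharP R 2] (a b : R) :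
    (a + b) ^ 4 = a ^ 4 + b ^ 4 := add_pow_char_pow (p := 2) (n := 2) a b

/-! ### Polynomials in `f` at a single place, and tameness there -/

section Local

variable {k K : Type*} [Field k] [Field K] [Algebra k K]

/-- Over a perfect field of characteristic `2`, polynomials in a fourth power are fourth powers. -/
theorem exists_aeval_pow_four [CharP k 2] [PerfectField k] [CharP K 2] (Q : k[X]) :
    ∃ R : k[X], ∀ d : K, aeval (d ^ 4) Q = aeval d R ^ 4 := by
  induction Q using Polynomial.induction_on' with
  | add p q hp hq =>
    obtain ⟨r, hr⟩ := hp
    obtain ⟨s, hs⟩ := hq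
    exact ⟨r + s, fun d => by rw [map_add, map_add, hr, hs, add_pow_four]⟩
  | monomial n c =>
    have hp : PerfectRing k 2 := PerfectField.toPerfectRing 2
    -- Perfectness gives each coefficient a fourth root.
    obtain ⟨e, rfl⟩ := (iterateFrobeniusEquiv k 2 2).surjective c
    refine ⟨monomial n e, fun d => ?_⟩
    simp only [aeval_monomial, iterateFrobeniusEquiv_apply, iterateFrobenius_def, map_pow]
    ring

theorem exists_eq_pow_mul_isCoprime {P : k[X]} (hirr : Irreducible P) {q : k[X]} (hq : q ≠ 0) :
    ∃ (i : ℕ) (r : k[X]), q = P ^ i * r ∧ IsCoprime P r := by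
  obtain ⟨r, hr, hdvd⟩ :=
    (FiniteMultiplicity.of_prime_left hirr.prime hq).exists_eq_pow_mul_and_not_dvd
  exact ⟨_, r, hr, (hirr.coprime_iff_not_dvd).2 hdvd⟩

namespace IsPlace

variable {w : Valuation K ℤᵐ⁰} (hw : IsPlace k w)
include hw

theorem map_algebraMap_eq_one {c : k} (hc : c ≠ 0) : w (algebraMap k K c) = 1 := by
  refine le_antisymm (hw.map_algebraMap_le_one c) ?_
  have h := hw.map_algebraMap_le_one c⁻¹
  rw [map_inv₀, map_inv₀] at h
  rwa [inv_le_one₀] at h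
  rw [zero_lt_iff, ne_eq, map_eq_zero, map_eq_zero]
  exact hc

theorem map_aeval_le_one {a : K} (ha : w a ≤ 1) (p : k[X]) : w (aeval a p) ≤ 1 := by
  induction p using Polynomial.induction_on' with
  | add p q hp hq =>
    rw [map_add]
    exact (w.map_add _ _).trans (max_le hp hq)
  | monomial n c =>
    rw [aeval_monomial, map_mul, map_pow]
    exact mul_le_one' (hw.map_algebraMap_le_one c) (pow_le_one' ha n)

theorem map_aeval_eq_one_of_isCoprime {a : K} (ha : w a ≤ 1) {P q : k[X]} (h : IsCoprime P q)
    (hP : w (aeval a P) < 1) : w (aeval a q) = 1 := by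
  obtain ⟨u, v, huv⟩ := h
  refine le_antisymm (hw.map_aeval_le_one ha q) ?_
  by_contra! hq
  have h1 : w (aeval a (u * P + v * q)) < 1 := by
    rw [map_add, map_mul, map_mul]
    refine w.map_add_lt ?_ ?_
    · rw [map_mul]
      rw [mul_comm]
      exact mul_lt_one_of_lt_of_le hP (hw.map_aeval_le_one ha u)
    · rw [map_mul]
      rw [mul_comm]
      exact mul_lt_one_of_lt_of_le hq (hw.map_aeval_le_one ha v)
  rw [huv, map_one, map_one] at h1
  exact lt_irrefl _ h1

/-- Taylor expansion with integral remainder. Where Q'(b) is a unit and a - b has positive order, it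
makes Q(a) - Q(b) a unit multiple of a - b. -/
theorem exists_taylor {a b : K} (ha : w a ≤ 1) (hb : w b ≤ 1) (Q : k[X]) :
    ∃ s, w s ≤ 1 ∧ aeval a Q = aeval b Q + (a - b) * (aeval b (derivative Q) + (a - b) * s) := by
  have hab : w (a - b) ≤ 1 := (w.map_sub _ _).trans (max_le ha hb)
  induction Q using Polynomial.induction_on with
  | C c => exact ⟨0, by simp, by simp⟩
  | add p q hp hq =>
    obtain ⟨s, hs, hs'⟩ := hp
    obtain ⟨t, ht, ht'⟩ := hq
    refine ⟨s + t, (w.map_add _ _).trans (max_le hs ht), ?_⟩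
    simp only [map_add, hs', ht']
    ring
  | monomial n c ih =>
    obtain ⟨s, hs, hs'⟩ := ih
    refine ⟨aeval b (derivative (C c * X ^ n)) + (a - b) * s + s * b, ?_, ?_⟩
    · refine (w.map_add _ _).trans (max_le ((w.map_add _ _).trans (max_le ?_ ?_)) ?_)
      · exact hw.map_aeval_le_one hb _
      · rw [map_mul]
        exact mul_le_one' hab hs
      · rw [map_mul]
        exact mul_le_one' hs hb
    · rw [pow_succ, ← mul_assoc, map_mul, hs', derivative_mul (f := C c * X ^ n) (g := X),
        derivative_X]
      simp only [map_add, map_mul, aeval_X, map_one]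
      ring

theorem map_aeval_derivative_eq_one [PerfectField k] {a : K} (ha : w a ≤ 1) {P : k[X]}
    (hirr : Irreducible P) (hP : w (aeval a P) < 1) : w (aeval a (derivative P)) = 1 :=
  hw.map_aeval_eq_one_of_isCoprime ha (PerfectField.separable_of_irreducible hirr) hP

/-- If a polynomial in `f` with simple reduction has odd order up to fourth powers, so has `f`. -/
theorem exists_not_isSquare_of_aeval [CharP k 2] [PerfectField k] [CharP K 2] {f : K}
    (hf : w f ≤ 1) {Q : k[X]} (hQ : w (aeval f (derivative Q)) = 1) {h : K}
    (hodd : ¬ IsSquare (w (aeval f Q + h ^ 4))) : ∃ g, ¬ IsSquare (w (f + g ^ 4)) := by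
  by_contra! hsq
  obtain ⟨R, hR⟩ := exists_aeval_pow_four (K := K) Q
  -- With z = f + g⁴ and y = h + R(g), Taylor gives Q(f) + h⁴ = z·unit + y⁴. Both z and y⁴ are
  -- assumed or known to have square value, so the left side can be odd only if they have equal
  -- value and cancel.
  have key : ∀ g, w g ≤ 1 → w (f + g ^ 4) < 1 →
      w (f + g ^ 4) = w (h + aeval g R) ^ 4 ∧ f + g ^ 4 ≠ 0 ∧
        w (aeval f Q + h ^ 4) ≤ w (f + g ^ 4) := by
    intro g hg hfg
    have hg4 : w (g ^ 4) ≤ 1 := by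
      rw [map_pow]
      exact pow_le_one' hg 4
    obtain ⟨s, hs, hs'⟩ := hw.exists_taylor hg4 hf Q
    rw [CharTwo.sub_eq_add, add_comm (g ^ 4) f] at hs'
    set z := f + g ^ 4 with hz
    have hu : w (aeval f (derivative Q) + z * s) = 1 := by
      rw [← hQ]
      refine w.map_add_eq_of_lt_left ?_
      rw [hQ, map_mul]
      exact mul_lt_one_of_lt_of_le hfg hs
    have hzu : w (z * (aeval f (derivative Q) + z * s)) = w z := by rw [map_mul, hu, mul_one]
    have heq : aeval f Q + h ^ 4 =
        z * (aeval f (derivative Q) + z * s) + (h + aeval g R) ^ 4 := by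
      rw [add_pow_four, ← hR, hs']
      linear_combination (-z * (aeval f (derivative Q) + z * s)) * CharTwo.two_eq_zero (R := K)
    have hzeq : w z = w (h + aeval g R) ^ 4 := by
      by_contra hne
      rcases lt_or_gt_of_ne hne with hlt | hlt
      · rw [heq, w.map_add_eq_of_lt_right (by rwa [hzu, map_pow]), map_pow] at hodd
        exact hodd (isSquare_pow_four _)
      · rw [heq, w.map_add_eq_of_lt_left (by rwa [hzu, map_pow]), hzu] at hodd
        exact hodd (hsq g)
    refine ⟨hzeq, ?_, ?_⟩
    · intro h0
      have h0' : w z = 0 := by rw [h0, map_zero]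
      have : w (aeval f Q + h ^ 4) = 0 := by
        rw [heq, h0, zero_mul, zero_add, map_pow, ← hzeq, h0', ]
      exact hodd (this ▸ ⟨0, by simp⟩)
    · rw [heq]
      refine (w.map_add _ _).trans (max_le hzu.le ?_)
      rw [map_pow, hzeq]
  -- Since z/y⁴ is a unit whose residue is a fourth power, replacing g by g + ry strictly raises the
  -- order of f + g⁴. By `key` that order is bounded by the order of Q(f) + h⁴, which gives the
  -- contradiction.
  have step : ∀ N : ℕ, ∃ g, w g ≤ 1 ∧ w (f + g ^ 4) ≤ exp (-(N : ℤ) - 1) := by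
    intro N
    induction N with
    | zero =>
      obtain ⟨u, hu, hu'⟩ := hw.exists_pow_four f hf
      refine ⟨u, hu, le_exp_sub_one_of_lt ?_⟩
      simpa using hu'
    | succ N ih =>
      obtain ⟨g, hg, hle⟩ := ih
      have hlt : w (f + g ^ 4) < 1 := by
        refine hle.trans_lt ?_
        rw [← exp_zero, exp_lt_exp]
        omega
      obtain ⟨h1, h2, -⟩ := key g hg hlt
      set y := h + aeval g R
      have hy : y ≠ 0 := by
        intro h0
        rw [h0, map_zero, zero_pow (by norm_num), map_eq_zero] at h1
        exact h2 h1
      have hy' : w y ^ 4 ≠ 0 := by simpa using hy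
      obtain ⟨r, hr, hr'⟩ := hw.exists_pow_four ((f + g ^ 4) / y ^ 4) (by
        rw [map_div₀, map_pow, h1, div_self hy'])
      have hy1 : w y ≤ 1 := by
        by_contra! hy1
        have : 1 < w y ^ 4 := one_lt_pow₀ hy1 (by norm_num)
        exact absurd (h1 ▸ hlt) (not_lt.2 this.le)
      refine ⟨g + r * y, (w.map_add _ _).trans (max_le hg ?_), ?_⟩
      · rw [map_mul]
        exact mul_le_one' hr hy1
      · have : f + (g + r * y) ^ 4 = ((f + g ^ 4) / y ^ 4 + r ^ 4) * y ^ 4 := by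
          rw [add_pow_four]
          field_simp
          ring
        have hlt2 : w (f + (g + r * y) ^ 4) < w (f + g ^ 4) := by
          rw [this, map_mul, h1, map_pow]
          exact mul_lt_of_lt_one_left (zero_lt_iff.2 hy') hr'
        have := le_exp_sub_one_of_lt (hlt2.trans_le hle)
        refine this.trans ?_
        rw [exp_le_exp]
        push_cast
        omega
  obtain ⟨n, -, hn⟩ := exists_exp_eq_of_not_isSquare hodd
  obtain ⟨g, hg, hle⟩ := step n.natAbs
  have hlt : w (f + g ^ 4) < 1 := by
    refine hle.trans_lt ?_
    rw [← exp_zero, exp_lt_exp]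
    omega
  have := ((key g hg hlt).2.2).trans hle
  rw [hn, exp_le_exp] at this
  omega

end IsPlace

/-- The least positive order at `w` of the elements of `k(f)` is odd. -/
def TameAt (k : Type*) [Field k] [Algebra k K] (w : Valuation K ℤᵐ⁰) (f : K) : Prop :=
  ∃ e : ℕ, Odd e ∧ (∃ t ∈ k⟮f⟯, w t = exp (-(e : ℤ))) ∧
    ∀ t ∈ k⟮f⟯, w t < 1 → w t ≤ exp (-(e : ℤ))

theorem adjoin_inv_eq (f : K) : k⟮f⁻¹⟯ = k⟮f⟯ := by
  refine le_antisymm ?_ ?_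
  · rw [IntermediateField.adjoin_simple_le_iff]
    exact inv_mem (IntermediateField.mem_adjoin_simple_self k f)
  · rw [IntermediateField.adjoin_simple_le_iff]
    simpa using inv_mem (IntermediateField.mem_adjoin_simple_self k f⁻¹)

theorem aeval_mem_adjoin (f : K) (p : k[X]) : aeval f p ∈ k⟮f⟯ :=
  IntermediateField.algebra_adjoin_le_adjoin k {f} (aeval_mem_adjoin_singleton k f)

theorem tameAt_inv_iff (w : Valuation K ℤᵐ⁰) (f : K) : TameAt k w f⁻¹ ↔ TameAt k w f := by
  rw [TameAt, TameAt, adjoin_inv_eq]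

theorem exists_eq_pow_mul_div_of_mem_adjoin {f : K} {P : k[X]} (hirr : Irreducible P) {t : K}
    (ht : t ∈ k⟮f⟯) (ht0 : t ≠ 0) :
    ∃ (i j : ℕ) (r s : k[X]), IsCoprime P r ∧ IsCoprime P s ∧
      t = aeval f P ^ i * aeval f r / (aeval f P ^ j * aeval f s) := by
  obtain ⟨p, q, rfl⟩ := (IntermediateField.mem_adjoin_simple_iff k t).1 ht
  have hp : p ≠ 0 := by
    rintro rfl
    simp at ht0
  have hq : q ≠ 0 := by
    rintro rfl
    simp at ht0
  obtain ⟨i, r, rfl, hr⟩ := exists_eq_pow_mul_isCoprime hirr hp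
  obtain ⟨j, s, rfl, hs⟩ := exists_eq_pow_mul_isCoprime hirr hq
  exact ⟨i, j, r, s, hr, hs, by simp⟩

namespace IsPlace

variable {w : Valuation K ℤᵐ⁰} (hw : IsPlace k w)
include hw

/-- By Bézout, polynomials prime to P take unit values at f. Only the powers of P(f) contribute, so
P(f) is a uniformizer for k(f) at the place. -/
theorem exists_map_eq_zpow_of_mem_adjoin {f : K} (hf : w f ≤ 1) {P : k[X]}
    (hirr : Irreducible P) (hP : w (aeval f P) < 1) (hP0 : aeval f P ≠ 0)
    {t : K} (ht : t ∈ k⟮f⟯) (ht0 : t ≠ 0) : ∃ i : ℤ, w t = w (aeval f P) ^ i := by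
  obtain ⟨i, j, r, s, hr, hs, rfl⟩ := exists_eq_pow_mul_div_of_mem_adjoin hirr ht ht0
  refine ⟨i - j, ?_⟩
  rw [map_div₀, map_mul, map_mul, map_pow, map_pow, hw.map_aeval_eq_one_of_isCoprime hf hr hP,
    hw.map_aeval_eq_one_of_isCoprime hf hs hP, mul_one, mul_one, zpow_sub₀ (by simpa using hP0),
    zpow_natCast, zpow_natCast]

theorem map_le_of_mem_adjoin {f : K} (hf : w f ≤ 1) {P : k[X]}
    (hirr : Irreducible P) (hP : w (aeval f P) < 1) (hP0 : aeval f P ≠ 0)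
    {t : K} (ht : t ∈ k⟮f⟯) (ht1 : w t < 1) : w t ≤ w (aeval f P) := by
  rcases eq_or_ne t 0 with rfl | ht0
  · simp
  obtain ⟨i, hi⟩ := hw.exists_map_eq_zpow_of_mem_adjoin hf hirr hP hP0 ht ht0
  have hpos : 0 < w (aeval f P) := by simpa [zero_lt_iff] using hP0
  rw [hi] at ht1 ⊢
  have hi0 : 0 < i := by
    by_contra! hi0
    exact absurd ht1 (not_lt.2 (one_le_zpow_of_nonpos₀ hpos hP.le hi0))
  calc w (aeval f P) ^ i ≤ w (aeval f P) ^ (1 : ℤ) := zpow_le_zpow_right_of_le_one₀ hpos hP.le hi0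
    _ = _ := zpow_one _

theorem tameAt_of_aeval {f : K} (hf : w f ≤ 1) {P : k[X]} (hirr : Irreducible P)
    (hP : w (aeval f P) < 1) (hodd : ¬ IsSquare (w (aeval f P))) : TameAt k w f := by
  obtain ⟨n, hn, hn'⟩ := exists_exp_eq_of_not_isSquare hodd
  have hn0 : n < 0 := by
    rwa [hn', ← exp_zero, exp_lt_exp] at hP
  have hne : aeval f P ≠ 0 := by
    intro h0
    rw [h0, map_zero] at hn'
    exact exp_ne_zero hn'.symm
  have he : exp (-((n.natAbs : ℕ) : ℤ)) = w (aeval f P) := by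
    rw [hn']
    congr 1
    omega
  refine ⟨n.natAbs, Int.natAbs_odd.2 hn, ⟨aeval f P, aeval_mem_adjoin f P, he.symm⟩, ?_⟩
  intro t ht ht1
  rw [he]
  exact hw.map_le_of_mem_adjoin hf hirr hP hne ht ht1

/-- Either f or f⁻¹ has positive odd order, so P = X serves, and both generate the same subfield. -/
theorem tameAt_of_not_isSquare {f : K} (hodd : ¬ IsSquare (w f)) : TameAt k w f := by
  have key : ∀ g : K, w g < 1 → ¬ IsSquare (w g) → TameAt k w g := fun g hg hg' =>
    hw.tameAt_of_aeval hg.le irreducible_X (by simpa using hg) (by simpa using hg')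
  rcases lt_trichotomy (w f) 1 with h | h | h
  · exact key f h hodd
  · exact absurd (h ▸ ⟨1, by simp⟩) hodd
  · rw [← tameAt_inv_iff]
    refine key _ ?_ ?_
    · rw [map_inv₀]
      exact inv_lt_one_of_one_lt₀ h
    · rw [map_inv₀]
      rintro ⟨y, hy⟩
      exact hodd ⟨y⁻¹, by rw [← mul_inv, ← hy, inv_inv]⟩

/-- Let P be irreducible with P(f) vanishing at the place. Then P(f) is P(d⁴) plus a unit multiple
of f + d⁴, since P' is a unit at f by separability. As P(d⁴) = R(d)⁴ has positive order, that order
is at least 4 and cannot affect order 1 or 3. -/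
theorem tameAt_of_add_pow_four [CharP k 2] [PerfectField k] [CharP K 2] {f d : K} (hf : w f ≤ 1)
    (hd : w d ≤ 1) (h : w (f + d ^ 4) = exp (-1) ∨ w (f + d ^ 4) = exp (-3)) : TameAt k w f := by
  obtain ⟨P, hirr, hP⟩ := hw.exists_irreducible f hf
  have hlt : w (f + d ^ 4) < 1 := by
    rcases h with h | h <;> rw [h, ← exp_zero, exp_lt_exp] <;> norm_num
  have hodd : ¬ IsSquare (w (f + d ^ 4)) := by
    rcases h with h | h <;> rw [h, isSquare_exp_iff] <;> decide
  have hge : exp (-3) ≤ w (f + d ^ 4) := by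
    rcases h with h | h <;> rw [h, exp_le_exp]
    norm_num
  have hd4 : w (d ^ 4) ≤ 1 := by
    rw [map_pow]
    exact pow_le_one' hd 4
  obtain ⟨R, hR⟩ := exists_aeval_pow_four (K := K) P
  obtain ⟨s, hs, hs'⟩ := hw.exists_taylor hd4 hf P
  rw [CharTwo.sub_eq_add, add_comm (d ^ 4) f] at hs'
  set z := f + d ^ 4
  have hu : w (aeval f (derivative P) + z * s) = 1 := by
    rw [← hw.map_aeval_derivative_eq_one hf hirr hP]
    refine w.map_add_eq_of_lt_left ?_
    rw [hw.map_aeval_derivative_eq_one hf hirr hP, map_mul]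
    exact mul_lt_one_of_lt_of_le hlt hs
  have hzu : w (z * (aeval f (derivative P) + z * s)) = w z := by rw [map_mul, hu, mul_one]
  have hsmall : w (aeval (d ^ 4) P) < w z := by
    have h1 : w (aeval (d ^ 4) P) < 1 := by
      rw [hs']
      exact w.map_add_lt hP (by rwa [hzu])
    rw [hR, map_pow] at h1 ⊢
    have h2 : w (aeval d R) < exp 0 := by
      by_contra! h2
      exact absurd h1 (not_lt.2 (one_le_pow₀ h2))
    calc w (aeval d R) ^ 4 ≤ exp (0 - 1) ^ 4 := pow_le_pow_left' (le_exp_sub_one_of_lt h2) 4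
      _ = exp (-4) := by rw [← exp_nsmul]; rfl
      _ < exp (-3) := by rw [exp_lt_exp]; norm_num
      _ ≤ _ := hge
  have hPz : w (aeval f P) = w z := by
    have : aeval f P = z * (aeval f (derivative P) + z * s) + aeval (d ^ 4) P := by
      rw [hs']
      linear_combination (-z * (aeval f (derivative P) + z * s)) * CharTwo.two_eq_zero (R := K)
    rw [this, w.map_add_eq_of_lt_left (by rwa [hzu]), hzu]
  exact hw.tameAt_of_aeval hf hirr hP (by rwa [hPz])

/-- The generator of the maximal ideal of the local ring of `k(f)` at `w`. -/
theorem exists_generator {f : K} (hf : Transcendental k f) (hf1 : w f ≤ 1) :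
    ∃ P : k[X], Irreducible P ∧ w (aeval f P) < 1 ∧ aeval f P ≠ 0 := by
  obtain ⟨P, hirr, hP⟩ := hw.exists_irreducible f hf1
  exact ⟨P, hirr, hP, fun h => hf ⟨P, hirr.ne_zero, h⟩⟩

/-- The uniformizer has the form t = P(f)r(f)/s(f) with r(f), s(f) units. Multiplying by s(f)⁴ turns
t + h⁴ into a polynomial in f plus a fourth power without changing parity. -/
theorem exists_not_isSquare_of_le_one [CharP k 2] [PerfectField k] [CharP K 2] {f t h : K}
    (hf : Transcendental k f) (hf1 : w f ≤ 1) (ht : t ∈ k⟮f⟯) (ht1 : w t < 1)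
    (hmax : ∀ s ∈ k⟮f⟯, w s < 1 → w s ≤ w t) (hodd : ¬ IsSquare (w (t + h ^ 4))) :
    ∃ g, ¬ IsSquare (w (f + g ^ 4)) := by
  obtain ⟨P, hirr, hP, hP0⟩ := hw.exists_generator hf hf1
  have hpos : 0 < w (aeval f P) := by simpa [zero_lt_iff] using hP0
  have ht0 : t ≠ 0 := by
    rintro rfl
    have := hmax _ (aeval_mem_adjoin f P) hP
    rw [map_zero] at this
    exact absurd this (not_le.2 hpos)
  have htP : w t = w (aeval f P) :=
    le_antisymm (hw.map_le_of_mem_adjoin hf1 hirr hP hP0 ht ht1)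
      (hmax _ (aeval_mem_adjoin f P) hP)
  obtain ⟨i, j, r, s, hr, hs, rfl⟩ := exists_eq_pow_mul_div_of_mem_adjoin hirr ht ht0
  have hr1 := hw.map_aeval_eq_one_of_isCoprime hf1 hr hP
  have hs1 := hw.map_aeval_eq_one_of_isCoprime hf1 hs hP
  have hij : i = j + 1 := by
    rw [map_div₀, map_mul, map_mul, map_pow, map_pow, hr1, hs1, mul_one, mul_one,
      div_eq_iff (pow_pos hpos j).ne', ← pow_succ'] at htP
    exact (pow_right_inj₀ hpos hP.ne).1 htP
  have hs0 : aeval f s ≠ 0 := by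
    intro h0
    rw [h0, map_zero] at hs1
    exact zero_ne_one hs1
  -- The derivative of Q at f is P'rs³ plus a multiple of P, hence a unit.
  refine hw.exists_not_isSquare_of_aeval hf1 (Q := P * r * s ^ 3) (h := h * aeval f s) ?_ ?_
  · have hP' := hw.map_aeval_derivative_eq_one hf1 hirr hP
    rw [mul_assoc, derivative_mul, map_add]
    have h1 : w (aeval f (derivative P) * aeval f (r * s ^ 3)) = 1 := by
      rw [map_mul, map_mul, map_pow, map_mul, map_pow, hP', hr1, hs1]
      simp
    rw [map_mul (aeval f) (derivative P), w.map_add_eq_of_lt_left, h1]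
    rw [h1, map_mul, map_mul]
    exact mul_lt_one_of_lt_of_le hP (hw.map_aeval_le_one hf1 _)
  · have heq : aeval f (P * r * s ^ 3) + (h * aeval f s) ^ 4 =
        (aeval f P ^ i * aeval f r / (aeval f P ^ j * aeval f s) + h ^ 4) * aeval f s ^ 4 := by
      rw [hij]
      simp only [map_mul, map_pow]
      field_simp
      ring
    rw [heq, map_mul, map_pow, isSquare_mul_pow_four_iff (by simpa using hs0)]
    exact hodd

/-- At a point where it is pseudotame, `f` has odd order up to adding a fourth power. -/
theorem exists_not_isSquare_add_pow_four [CharP k 2] [PerfectField k] [CharP K 2] {f t h : K}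
    (hf : Transcendental k f) (ht : t ∈ k⟮f⟯) (ht1 : w t < 1)
    (hmax : ∀ s ∈ k⟮f⟯, w s < 1 → w s ≤ w t) (hodd : ¬ IsSquare (w (t + h ^ 4))) :
    ∃ g, ¬ IsSquare (w (f + g ^ 4)) := by
  rcases le_or_gt (w f) 1 with hf1 | hf1
  · exact hw.exists_not_isSquare_of_le_one hf hf1 ht ht1 hmax hodd
  have hf0 : f ≠ 0 := by
    rintro rfl
    simp at hf1
  have hinv : w f⁻¹ < 1 := by
    rw [map_inv₀]
    exact inv_lt_one_of_one_lt₀ hf1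
  rw [← adjoin_inv_eq] at ht hmax
  have hft : Transcendental k f⁻¹ := fun h => hf (by simpa using h.inv)
  obtain ⟨g, hg⟩ := hw.exists_not_isSquare_of_le_one hft hinv.le ht ht1 hmax hodd
  by_cases hsq : IsSquare (w f)
  swap
  · exact ⟨0, by simpa using hsq⟩
  -- Now f has even order, so odd order of f⁻¹ + g⁴ forces cancellation. Then f + g⁻⁴ = (f⁻¹ +
  -- g⁴)·f·g⁻⁴ has the same parity, as f and g⁻⁴ have equal value.
  have hg4 : w f⁻¹ = w g ^ 4 := by
    by_contra hne
    rcases lt_or_gt_of_ne hne with hlt | hlt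
    · rw [w.map_add_eq_of_lt_right (by rwa [map_pow]), map_pow] at hg
      exact hg (isSquare_pow_four _)
    · rw [w.map_add_eq_of_lt_left (by rwa [map_pow]), map_inv₀] at hg
      obtain ⟨y, hy⟩ := hsq
      exact hg ⟨y⁻¹, by rw [hy, mul_inv]⟩
  have hg0 : g ≠ 0 := by
    rintro rfl
    simp [hf0] at hg4
  refine ⟨g⁻¹, ?_⟩
  have heq : f + g⁻¹ ^ 4 = (f⁻¹ + g ^ 4) * f * g⁻¹ ^ 4 := by
    field_simp
    ring
  have hwf : w f = w g⁻¹ ^ 4 := by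
    rw [map_inv₀, inv_pow, ← hg4, map_inv₀, inv_inv]
  rw [heq, map_mul, map_mul, map_pow, hwf, isSquare_mul_pow_four_iff (by simpa using hg0),
    isSquare_mul_pow_four_iff (by simpa using hg0)]
  exact hg

end IsPlace

end Local

end PseudotameCurve

namespace PseudotameCurve

open Polynomial WithZero
open scoped IntermediateField

/-! ### Approximation -/

theorem eventually_pow_mul_lt {β ε : ℤᵐ⁰} (γ : ℤᵐ⁰) (hβ : β < 1) (hε : ε ≠ 0) :
    ∀ᶠ M : ℕ in Filter.atTop, β ^ M * γ < ε := by
  rcases eq_or_ne γ 0 with rfl | hγ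
  · exact Filter.Eventually.of_forall fun M => by simpa [zero_lt_iff] using hε
  have hβ' : β ≤ exp (-1) := by
    have := le_exp_sub_one_of_lt (n := 0) (by simpa using hβ)
    simpa using this
  filter_upwards [Filter.eventually_ge_atTop (log γ - log ε + 1).natAbs] with M hM
  calc β ^ M * γ ≤ exp (-1) ^ M * γ := mul_le_mul_left (pow_le_pow_left' hβ' M) γ
    _ = exp (-M + log γ) := by
      rw [exp_add, exp_log hγ, ← exp_nsmul]
      simp
    _ < exp (log ε) := by
      rw [exp_lt_exp]
      omega
    _ = ε := exp_log hε

theorem eventually_pow_lt {β ε : ℤᵐ⁰} (hβ : β < 1) (hε : ε ≠ 0) :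
    ∀ᶠ M : ℕ in Filter.atTop, β ^ M < ε := by
  simpa using eventually_pow_mul_lt 1 hβ hε

theorem eventually_lt_pow {β : ℤᵐ⁰} (γ : ℤᵐ⁰) (hβ : 1 < β) :
    ∀ᶠ M : ℕ in Filter.atTop, γ < β ^ M := by
  filter_upwards [eventually_pow_mul_lt γ (inv_lt_one_of_one_lt₀ hβ) one_ne_zero] with M hM
  rwa [inv_pow, ← div_eq_inv_mul, div_lt_one₀ (pow_pos (zero_lt_one.trans hβ) M)] at hM

/-- The real absolute value attached to a discrete valuation. -/
noncomputable def realAbsoluteValue {K : Type*} [Field K] (w : Valuation K ℤᵐ⁰) :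
    AbsoluteValue K ℝ where
  toFun a := WithZeroMulInt.toNNReal (e := 2) two_ne_zero (w a)
  map_mul' a b := by simp
  nonneg' a := NNReal.coe_nonneg _
  eq_zero' a := by simp
  add_le' a b := by
    have hmono := (WithZeroMulInt.toNNReal_strictMono (e := 2) one_lt_two).monotone
    rcases le_total (w a) (w b) with h | h
    · have := hmono ((w.map_add a b).trans_eq (max_eq_right h))
      refine (NNReal.coe_le_coe.2 this).trans ?_
      exact le_add_of_nonneg_left (NNReal.coe_nonneg _)
    · have := hmono ((w.map_add a b).trans_eq (max_eq_left h))
      refine (NNReal.coe_le_coe.2 this).trans ?_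
      exact le_add_of_nonneg_right (NNReal.coe_nonneg _)

theorem realAbsoluteValue_le_iff {K : Type*} [Field K] (w : Valuation K ℤᵐ⁰) (a b : K) :
    realAbsoluteValue w a ≤ realAbsoluteValue w b ↔ w a ≤ w b :=
  NNReal.coe_le_coe.trans (WithZeroMulInt.toNNReal_strictMono (e := 2) one_lt_two).le_iff_le

theorem realAbsoluteValue_lt_iff {K : Type*} [Field K] (w : Valuation K ℤᵐ⁰) (a b : K) :
    realAbsoluteValue w a < realAbsoluteValue w b ↔ w a < w b :=
  NNReal.coe_lt_coe.trans (WithZeroMulInt.toNNReal_strictMono (e := 2) one_lt_two).lt_iff_lt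

/-- A family of independent places of `K` at which every nonzero function is almost everywhere a
unit, such as the closed points of a smooth separated curve. -/
structure IsCurve (k : Type*) {K ι : Type*} [Field k] [Field K] [Algebra k K]
    (w : ι → Valuation K ℤᵐ⁰) : Prop where
  isPlace : ∀ x, IsPlace k (w x)
  finite_ne_one : ∀ a, a ≠ 0 → {x | w x a ≠ 1}.Finite
  exists_le_one_one_lt : ∀ x y, x ≠ y → ∃ a, w x a ≤ 1 ∧ 1 < w y a

namespace IsCurve

variable {k K ι : Type*} [Field k] [Field K] [Algebra k K] {w : ι → Valuation K ℤᵐ⁰}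
  (hC : IsCurve k w)
include hC

theorem finite_one_lt (a : K) : {x | 1 < w x a}.Finite := by
  rcases eq_or_ne a 0 with rfl | ha
  · simp
  · exact (hC.finite_ne_one a ha).subset fun x hx => ne_of_gt hx

/-- The Artin–Whaples separation of pairwise inequivalent absolute values. A function regular at one
place with a pole at the other rules out equivalence. -/
theorem exists_one_lt_lt_one (T : Finset ι) {x : ι} (hx : x ∈ T) :
    ∃ a, 1 < w x a ∧ ∀ y ∈ T, y ≠ x → w y a < 1 := by
  obtain ⟨a, ha, ha'⟩ := AbsoluteValue.exists_one_lt_lt_one_pi_of_not_isEquiv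
    (v := fun i : T => realAbsoluteValue (w i)) (fun i => by
      obtain ⟨ϖ, hϖ⟩ := (hC.isPlace i).exists_uniformizer
      refine ⟨ϖ, ?_, ?_⟩
      · rintro rfl
        rw [map_zero] at hϖ
        exact exp_ne_zero hϖ.symm
      · refine ne_of_lt ?_
        rw [← map_one (realAbsoluteValue (w i)), realAbsoluteValue_lt_iff, hϖ, map_one, ← exp_zero,
          exp_lt_exp]
        norm_num) (fun i j hij h => by
      obtain ⟨a, ha, ha'⟩ := hC.exists_le_one_one_lt i j (fun h => hij (Subtype.ext h))
      have := (h a 1).1 ((realAbsoluteValue_le_iff _ _ _).2 (by simpa using ha))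
      rw [realAbsoluteValue_le_iff, map_one] at this
      exact absurd ha' (not_lt.2 this)) ⟨x, hx⟩
  refine ⟨a, ?_, fun y hy hyx => ?_⟩
  · rwa [← map_one (realAbsoluteValue (w x)), realAbsoluteValue_lt_iff, map_one] at ha
  · have := ha' ⟨y, hy⟩ (by simpa using hyx)
    rwa [← map_one (realAbsoluteValue (w y)), realAbsoluteValue_lt_iff, map_one] at this

/-- Weak approximation. -/
theorem exists_forall_sub_lt (T : Finset ι) (y : ι → K) {ε : ι → ℤᵐ⁰} (hε : ∀ x, ε x ≠ 0) :
    ∃ z, ∀ x ∈ T, w x (z - y x) < ε x := by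
  classical
  have h1 : ∀ x : ι, ∃ a, x ∈ T → 1 < w x a ∧ ∀ y ∈ T, y ≠ x → w y a < 1 := fun x => by
    by_cases hx : x ∈ T
    · obtain ⟨a, ha⟩ := hC.exists_one_lt_lt_one T hx
      exact ⟨a, fun _ => ha⟩
    · exact ⟨0, fun h => absurd h hx⟩
  choose a ha using h1
  -- The functions aᴹ/(1 + aᴹ) are approximate idempotents: close to 1 at their own place and to 0
  -- at the other places of `T`.
  have h2 : ∀ᶠ M : ℕ in Filter.atTop, ∀ x ∈ T, ∀ x' ∈ T,
      w x ((a x' ^ M / (1 + a x' ^ M) - if x = x' then 1 else 0) * y x') < ε x := by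
    rw [Filter.eventually_all_finset]
    intro x hx
    rw [Filter.eventually_all_finset]
    intro x' hx'
    by_cases hxx : x = x'
    · subst hxx
      have h1 := (ha x hx).1
      have hinv : w x (a x)⁻¹ < 1 := by
        rw [map_inv₀]
        exact inv_lt_one_of_one_lt₀ h1
      filter_upwards [eventually_pow_mul_lt (w x (y x)) hinv (hε x),
        Filter.eventually_ge_atTop 1] with M hM hM1
      have hpow : 1 < w x (a x ^ M) := by
        rw [map_pow]
        exact one_lt_pow₀ h1 (by omega)
      have hw1 : w x (1 + a x ^ M) = w x (a x ^ M) :=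
        (w x).map_add_eq_of_lt_right (by rwa [map_one])
      have hne : 1 + a x ^ M ≠ 0 := by
        intro h0
        rw [h0, map_zero] at hw1
        rw [← hw1] at hpow
        exact not_lt_zero hpow
      have : a x ^ M / (1 + a x ^ M) - 1 = -(1 + a x ^ M)⁻¹ := by
        field_simp
        ring
      rw [if_pos rfl, this, map_mul, Valuation.map_neg, map_inv₀, hw1, map_pow, ← inv_pow,
        ← map_inv₀]
      exact hM
    · have h1 := (ha x' hx').2 x hx hxx
      filter_upwards [eventually_pow_mul_lt (w x (y x')) h1 (hε x),
        Filter.eventually_ge_atTop 1] with M hM hM1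
      have hpow : w x (a x' ^ M) < 1 := by
        rw [map_pow]
        exact pow_lt_one₀ zero_le h1 (by omega)
      have hw1 : w x (1 + a x' ^ M) = 1 := by
        rw [(w x).map_add_eq_of_lt_left (by rwa [map_one]), map_one]
      rw [if_neg hxx, sub_zero, map_mul, map_div₀, hw1, div_one, map_pow]
      exact hM
  obtain ⟨M, hM⟩ := h2.exists
  refine ⟨∑ x' ∈ T, a x' ^ M / (1 + a x' ^ M) * y x', fun x hx => ?_⟩
  have : ∑ x' ∈ T, a x' ^ M / (1 + a x' ^ M) * y x' - y x =
      ∑ x' ∈ T, (a x' ^ M / (1 + a x' ^ M) - if x = x' then 1 else 0) * y x' := by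
    simp [sub_mul, Finset.sum_sub_distrib, hx]
  rw [this]
  exact (w x).map_sum_lt (hε x) fun x' hx' => hM x hx x' hx'

/-- At a pole of a the leading term dominates, nonzero constants being units. -/
theorem map_aeval_of_one_lt {a : K} {x : ι} (ha : 1 < w x a) {p : k[X]} (hp : p ≠ 0) :
    w x (aeval a p) = w x a ^ p.natDegree := by
  induction h : p.natDegree using Nat.strong_induction_on generalizing p with
  | _ n ih =>
    have hlead : w x (aeval a (monomial p.natDegree p.leadingCoeff)) = w x a ^ n := by
      rw [aeval_monomial, map_mul, map_pow,
        (hC.isPlace x).map_algebraMap_eq_one (leadingCoeff_ne_zero.2 hp), one_mul, h]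
    rw [← eraseLead_add_monomial_natDegree_leadingCoeff p, map_add]
    by_cases h0 : p.eraseLead = 0
    · rw [h0, map_zero, zero_add, hlead]
    · have hlt : p.eraseLead.natDegree < n := by
        rw [← h]
        exact (eraseLead_natDegree_lt_or_eraseLead_eq_zero p).resolve_right h0
      rw [(w x).map_add_eq_of_lt_right, hlead]
      rw [hlead, ih _ hlt h0 rfl]
      exact pow_lt_pow_right₀ ha hlt

theorem exists_polynomial_lt_one {a : K} (T : Finset ι) (hT : ∀ x ∈ T, w x a ≤ 1) :
    ∃ p : k[X], 0 < p.natDegree ∧ ∀ x ∈ T, w x (aeval a p) < 1 := by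
  classical
  induction T using Finset.induction_on with
  | empty => exact ⟨X, by simp, by simp⟩
  | insert y T hy ih =>
    obtain ⟨p, hp, hpT⟩ := ih fun x hx => hT x (Finset.mem_insert_of_mem hx)
    have hya := hT y (Finset.mem_insert_self y T)
    obtain ⟨P, hirr, hP⟩ := (hC.isPlace y).exists_irreducible a hya
    refine ⟨P * p, ?_, fun x hx => ?_⟩
    · rw [natDegree_mul hirr.ne_zero (ne_zero_of_natDegree_gt hp)]
      omega
    · rw [map_mul, map_mul]
      rcases Finset.mem_insert.1 hx with rfl | hx
      · exact mul_lt_one_of_lt_of_le hP ((hC.isPlace x).map_aeval_le_one hya _)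
      · rw [mul_comm]
        exact mul_lt_one_of_lt_of_le (hpT x hx)
          ((hC.isPlace x).map_aeval_le_one (hT x (Finset.mem_insert_of_mem hx)) _)

/-- The irreducible polynomial killing the residue of a cannot divide p where p(a) is a unit, so a
product of such polynomials is prime to p. -/
theorem exists_isCoprime_lt_one {a : K} (T : Finset ι) (hT : ∀ x ∈ T, w x a ≤ 1) {p : k[X]}
    (hp : ∀ x ∈ T, w x (aeval a p) = 1) :
    ∃ b : k[X], IsCoprime b p ∧ ∀ x ∈ T, w x (aeval a b) < 1 := by
  classical
  induction T using Finset.induction_on with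
  | empty => exact ⟨1, isCoprime_one_left, by simp⟩
  | insert y T hy ih =>
    obtain ⟨b, hb, hbT⟩ := ih (fun x hx => hT x (Finset.mem_insert_of_mem hx))
      fun x hx => hp x (Finset.mem_insert_of_mem hx)
    have hya := hT y (Finset.mem_insert_self y T)
    obtain ⟨P, hirr, hP⟩ := (hC.isPlace y).exists_irreducible a hya
    refine ⟨P * b, IsCoprime.mul_left ?_ hb, fun x hx => ?_⟩
    · rw [hirr.coprime_iff_not_dvd]
      rintro ⟨q, rfl⟩
      have := hp y (Finset.mem_insert_self y T)
      rw [map_mul, map_mul] at this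
      exact (mul_lt_one_of_lt_of_le hP ((hC.isPlace y).map_aeval_le_one hya q)).ne this
    · rw [map_mul, map_mul]
      rcases Finset.mem_insert.1 hx with rfl | hx
      · exact mul_lt_one_of_lt_of_le hP ((hC.isPlace x).map_aeval_le_one hya _)
      · rw [mul_comm]
        exact mul_lt_one_of_lt_of_le (hbT x hx)
          ((hC.isPlace x).map_aeval_le_one (hT x (Finset.mem_insert_of_mem hx)) _)

/-- Strong approximation away from the poles of `a`. -/
theorem exists_forall_sub_lt_of_le_one {a : K} (ha : Transcendental k a) (S : Finset ι)
    (hS : ∀ x ∈ S, w x a ≤ 1) (y : ι → K) {ε : ι → ℤᵐ⁰} (hε : ∀ x, ε x ≠ 0) :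
    ∃ h, (∀ x ∈ S, w x (h - y x) < ε x) ∧ ∀ x, w x a ≤ 1 → x ∉ S → w x h ≤ 1 := by
  classical
  obtain ⟨p, hp, hpS⟩ := hC.exists_polynomial_lt_one S hS
  have hp0 : aeval a p ≠ 0 := fun h => ha ⟨p, ne_zero_of_natDegree_gt hp, h⟩
  -- Weak approximation is imposed wherever p(a) is not a unit, which includes `S`. Off `S` the
  -- target is 0, so the remaining unwanted poles of z lie where p(a) is a unit.
  obtain ⟨z, hz⟩ := hC.exists_forall_sub_lt (hC.finite_ne_one _ hp0).toFinset
    (fun x => if x ∈ S then y x else 0) (ε := fun x => if x ∈ S then ε x else 1) (fun x => by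
      split_ifs
      · exact hε x
      · exact one_ne_zero)
  have hfin : {x | 1 < w x z ∧ w x a ≤ 1 ∧ w x (aeval a p) = 1}.Finite :=
    (hC.finite_one_lt z).subset fun x hx => hx.1
  obtain ⟨b, hb, hbT⟩ := hC.exists_isCoprime_lt_one hfin.toFinset (a := a) (p := p)
    (fun x hx => by simp only [Set.Finite.mem_toFinset, Set.mem_ofPred_eq] at hx; exact hx.2.1)
    (fun x hx => by simp only [Set.Finite.mem_toFinset, Set.mem_ofPred_eq] at hx; exact hx.2.2)
  have hM1 : ∀ᶠ M : ℕ in Filter.atTop, ∀ x ∈ hfin.toFinset, w x (aeval a b) ^ M * w x z < 1 := by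
    rw [Filter.eventually_all_finset]
    exact fun x hx => eventually_pow_mul_lt _ (hbT x hx) one_ne_zero
  have hM2 : ∀ᶠ M : ℕ in Filter.atTop, ∀ x ∈ S, w x (aeval a p) ^ M * w x z < ε x := by
    rw [Filter.eventually_all_finset]
    exact fun x hx => eventually_pow_mul_lt _ (hpS x hx) (hε x)
  obtain ⟨M, hM1, hM2⟩ := (hM1.and hM2).exists
  -- From u·bᴹ + v·pᴹ = 1, the function u·bᴹ·z has the unwanted poles of z removed by bᴹ, and it
  -- differs from z by v·pᴹ·z, which is small on `S`.
  obtain ⟨u, v, huv⟩ := hb.pow (m := M) (n := M)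
  have huv' := congrArg (aeval a) huv
  simp only [map_add, map_mul, map_pow, map_one] at huv'
  refine ⟨aeval a u * aeval a b ^ M * z, fun x hx => ?_, fun x hx hxS => ?_⟩
  · have hx1 := hS x hx
    have hzx := hz x (by simpa using (hpS x hx).ne)
    rw [if_pos hx, if_pos hx] at hzx
    have : aeval a u * aeval a b ^ M * z - y x =
        (z - y x) - aeval a v * (aeval a p ^ M * z) := by
      linear_combination z * huv'
    rw [this]
    refine (w x).map_sub_lt hzx ?_
    rw [map_mul, map_mul, map_pow]
    exact (mul_le_of_le_one_left' ((hC.isPlace x).map_aeval_le_one hx1 v)).trans_lt (hM2 x hx)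
  · rw [mul_assoc, map_mul]
    refine mul_le_one' ((hC.isPlace x).map_aeval_le_one hx u) ?_
    rw [map_mul]
    by_cases hzx : w x z ≤ 1
    · refine mul_le_one' ?_ hzx
      rw [map_pow]
      exact pow_le_one' ((hC.isPlace x).map_aeval_le_one hx b) M
    · rw [map_pow]
      refine (hM1 x ?_).le
      simp only [Set.Finite.mem_toFinset, Set.mem_ofPred_eq]
      refine ⟨not_le.1 hzx, hx, ?_⟩
      by_contra hne
      have := hz x (by simpa using hne)
      rw [if_neg hxS, if_neg hxS, sub_zero] at this
      exact hzx this.le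

theorem exists_polynomial_mul_le_one {a : K} (e : K) :
    ∃ p : k[X], p ≠ 0 ∧ ∀ x, w x a ≤ 1 → w x (aeval a p * e) ≤ 1 := by
  have hfin : {x | 1 < w x e ∧ w x a ≤ 1}.Finite :=
    (hC.finite_one_lt e).subset fun x hx => hx.1
  obtain ⟨p, hp, hpT⟩ := hC.exists_polynomial_lt_one hfin.toFinset (a := a)
    (fun x hx => by simp only [Set.Finite.mem_toFinset, Set.mem_ofPred_eq] at hx; exact hx.2)
  have hM : ∀ᶠ M : ℕ in Filter.atTop, ∀ x ∈ hfin.toFinset, w x (aeval a p) ^ M * w x e < 1 := by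
    rw [Filter.eventually_all_finset]
    exact fun x hx => eventually_pow_mul_lt _ (hpT x hx) one_ne_zero
  obtain ⟨M, hM⟩ := hM.exists
  refine ⟨p ^ M, pow_ne_zero _ (ne_zero_of_natDegree_gt hp), fun x hx => ?_⟩
  rw [map_mul]
  by_cases hex : w x e ≤ 1
  · exact mul_le_one' ((hC.isPlace x).map_aeval_le_one hx _) hex
  · rw [map_pow, map_pow]
    refine (hM x ?_).le
    simp only [Set.Finite.mem_toFinset, Set.mem_ofPred_eq]
    exact ⟨not_le.1 hex, hx⟩

/-- Every function differs from one that is regular away from the poles of `a` by a function of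
bounded order at the poles of `a`. -/
theorem exists_bound {a : K} (hfin : FiniteDimensional k⟮a⟯ K) :
    ∃ B : ℤᵐ⁰, ∀ y, ∃ d, (∀ x, w x a ≤ 1 → w x d ≤ 1) ∧ ∀ x, 1 < w x a → w x (d - y) ≤ B := by
  classical
  let b := Module.finBasis k⟮a⟯ K
  -- Polynomials in a make the basis regular away from the poles of a. The values of the rescaled
  -- basis at those poles then give `B`.
  choose p hp hpa using fun i => hC.exists_polynomial_mul_le_one (a := a) (b i)
  by_cases halg : Transcendental k a
  swap
  · have ha : ∀ x, w x a ≤ 1 := by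
      intro x
      by_contra! hx
      rw [Transcendental, not_not] at halg
      obtain ⟨q, hq, hqa⟩ := halg
      have := hC.map_aeval_of_one_lt hx hq
      rw [hqa, map_zero] at this
      exact (pow_pos (zero_lt_one.trans hx) _).ne this
    exact ⟨0, fun y => ⟨0, by simp, fun x hx => absurd hx (not_lt.2 (ha x))⟩⟩
  have hpa0 : ∀ i, aeval a (p i) ≠ 0 := fun i h => halg ⟨p i, hp i, h⟩
  obtain ⟨B, hB⟩ : ∃ B, ∀ x ∈ (hC.finite_one_lt a).toFinset, ∀ i,
      w x (aeval a (p i) * b i) ≤ B := by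
    refine ⟨(hC.finite_one_lt a).toFinset.sup fun x => Finset.univ.sup fun i =>
      w x (aeval a (p i) * b i), fun x hx i => ?_⟩
    refine le_trans ?_ (Finset.le_sup hx)
    exact Finset.le_sup (f := fun i => w x (aeval a (p i) * b i)) (Finset.mem_univ i)
  refine ⟨B, fun y => ?_⟩
  -- Each coordinate in k(a) is replaced by its polynomial part. The remaining proper fraction is
  -- regular at the poles of a.
  have hrep : ∀ i, ∃ q : k[X], ∀ x, 1 < w x a →
      w x (aeval a q - (b.repr y i : K) / aeval a (p i)) ≤ 1 := by
    intro i
    have hmem : (b.repr y i : K) / aeval a (p i) ∈ k⟮a⟯ :=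
      div_mem (b.repr y i).2 (aeval_mem_adjoin a (p i))
    obtain ⟨r, s, hrs⟩ := (IntermediateField.mem_adjoin_simple_iff k _).1 hmem
    rw [hrs]
    by_cases hs : s = 0
    · exact ⟨0, by simp [hs]⟩
    refine ⟨r / s, fun x hx => ?_⟩
    have hsa : aeval a s ≠ 0 := fun h => halg ⟨s, hs, h⟩
    have hdiv := congrArg (aeval a) (EuclideanDomain.div_add_mod r s)
    rw [map_add, map_mul] at hdiv
    have : aeval a (r / s) - aeval a r / aeval a s = -(aeval a (r % s) / aeval a s) := by
      rw [← hdiv]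
      field_simp
      ring
    rw [this, Valuation.map_neg, map_div₀]
    by_cases hr : r % s = 0
    · simp [hr]
    refine div_le_one_of_le₀ ?_ zero_le
    rw [hC.map_aeval_of_one_lt hx hr, hC.map_aeval_of_one_lt hx hs]
    exact pow_le_pow_right₀ hx.le (natDegree_le_natDegree (EuclideanDomain.mod_lt r hs).le)
  choose q hq using hrep
  refine ⟨∑ i, aeval a (q i) * (aeval a (p i) * b i), fun x hx => ?_, fun x hx => ?_⟩
  · refine (w x).map_sum_le fun i _ => ?_
    rw [map_mul]
    exact mul_le_one' ((hC.isPlace x).map_aeval_le_one hx _) (hpa i x hx)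
  · have hy : y = ∑ i, (b.repr y i : K) * b i := by
      conv_lhs => rw [← b.sum_repr y]
      rfl
    have : ∑ i, aeval a (q i) * (aeval a (p i) * b i) - y =
        ∑ i, (aeval a (q i) - (b.repr y i : K) / aeval a (p i)) * (aeval a (p i) * b i) := by
      conv_lhs => rw [hy]
      rw [← Finset.sum_sub_distrib]
      refine Finset.sum_congr rfl fun i _ => ?_
      have := hpa0 i
      field_simp
    rw [this]
    refine (w x).map_sum_le fun i _ => ?_
    rw [map_mul]
    exact (mul_le_of_le_one_left' (hq i x hx)).trans (hB x (by simpa using hx) i)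

end IsCurve

end PseudotameCurve

namespace PseudotameCurve

open Polynomial WithZero
open scoped IntermediateField

/-! ### Making a pseudotame function tame -/

/-- `f` is regular at `w`, and a uniformizer up to adding a regular fourth power. -/
def UnramifiedAt {K : Type*} [Field K] (w : Valuation K ℤᵐ⁰) (f : K) : Prop :=
  w f ≤ 1 ∧ ∃ u, w u ≤ 1 ∧ w (f + u ^ 4) = exp (-1)

theorem not_isSquare_pow_three {x : ℤᵐ⁰} (hx : ¬ IsSquare x) : ¬ IsSquare (x ^ 3) := by
  obtain ⟨n, hn, rfl⟩ := exists_exp_eq_of_not_isSquare hx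
  rw [← exp_nsmul, isSquare_exp_iff, Int.not_even_iff_odd]
  exact Odd.mul (by decide) hn

theorem ne_zero_of_not_isSquare {x : ℤᵐ⁰} (hx : ¬ IsSquare x) : x ≠ 0 := by
  rintro rfl
  exact hx ⟨0, by simp⟩

theorem pow_four_lt_of_le {a b c : ℤᵐ⁰} (hab : a ≤ b) (hb : b ^ 4 < c) : a ^ 4 < c :=
  (pow_le_pow_left' hab 4).trans_lt hb

/-! ### The cubic transform at an unramified place -/

section Local

variable {k K : Type*} [Field k] [Field K] [Algebra k K] [CharP K 2]

theorem UnramifiedAt.add_pow_four {w : Valuation K ℤᵐ⁰} {f h : K} (hf : UnramifiedAt w f)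
    (hh : w h ≤ 1) : UnramifiedAt w (f + h ^ 4) := by
  obtain ⟨hf1, u, hu, huf⟩ := hf
  refine ⟨(w.map_add _ _).trans (max_le hf1 ?_), u + h,
    (w.map_add _ _).trans (max_le hu hh), ?_⟩
  · rw [map_pow]
    exact pow_le_one' hh 4
  · rw [PseudotameCurve.add_pow_four u h, ← huf]
    congr 1
    linear_combination h ^ 4 * CharTwo.two_eq_zero (R := K)

/-- Write f = z + v⁴ with z of order 1. If v vanishes, f has order 1 and f³ has order 3. If v is a
unit, so is f, and f³ + (f/v)⁴ = f³(f + v⁴)/v⁴ has order 1. -/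
theorem IsPlace.tameAt_cube_add_of_unramifiedAt [CharP k 2] [PerfectField k]
    {w : Valuation K ℤᵐ⁰} (hw : IsPlace k w) {f d : K} (hf : UnramifiedAt w f) (hd : w d ≤ 1) :
    TameAt k w (f ^ 3 + d ^ 4) := by
  obtain ⟨hf1, v, hv, hz⟩ := hf
  have hd4 : w (d ^ 4) ≤ 1 := by
    rw [map_pow]
    exact pow_le_one' hd 4
  have hint : w (f ^ 3 + d ^ 4) ≤ 1 := by
    refine (w.map_add _ _).trans (max_le ?_ hd4)
    rw [map_pow]
    exact pow_le_one' hf1 3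
  have hz1 : w (f + v ^ 4) < 1 := by
    rw [hz, ← exp_zero, exp_lt_exp]
    norm_num
  have hfv : f = (f + v ^ 4) + v ^ 4 := by
    linear_combination (-v ^ 4) * CharTwo.two_eq_zero (R := K)
  rcases lt_or_eq_of_le hv with hv1 | hv1
  · have hv4 : w (v ^ 4) < exp (-1) := by
      have h2 : w v ≤ exp (0 - 1) := le_exp_sub_one_of_lt (by simpa using hv1)
      rw [map_pow]
      calc w v ^ 4 ≤ exp (0 - 1) ^ 4 := pow_le_pow_left' h2 4
        _ = exp (-4) := by rw [← exp_nsmul]; rfl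
        _ < exp (-1) := by rw [exp_lt_exp]; norm_num
    have hwf : w f = exp (-1) := by
      rw [hfv, w.map_add_eq_of_lt_left (by rwa [hz]), hz]
    refine hw.tameAt_of_add_pow_four hint hd (Or.inr ?_)
    have : f ^ 3 + d ^ 4 + d ^ 4 = f ^ 3 := by
      linear_combination d ^ 4 * CharTwo.two_eq_zero (R := K)
    rw [this, map_pow, hwf, ← exp_nsmul]
    rfl
  · have hv4 : w (v ^ 4) = 1 := by rw [map_pow, hv1, one_pow]
    have hwf : w f = 1 := by
      rw [hfv, w.map_add_eq_of_lt_right (by rwa [hv4]), hv4]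
    have hv0 : v ≠ 0 := by
      rintro rfl
      simp at hv1
    have hq : w (f / v) = 1 := by rw [map_div₀, hwf, hv1, div_one]
    refine hw.tameAt_of_add_pow_four hint (d := f / v + d)
      ((w.map_add _ _).trans (max_le hq.le hd)) (Or.inl ?_)
    have : f ^ 3 + d ^ 4 + (f / v + d) ^ 4 = f ^ 3 * (f + v ^ 4) / v ^ 4 := by
      rw [PseudotameCurve.add_pow_four]
      field_simp
      linear_combination (v ^ 4 * d ^ 4) * CharTwo.two_eq_zero (R := K)
    rw [this, map_div₀, map_mul, hz, hv4, map_pow, hwf]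
    simp

end Local

/-! ### The global choice of h and d -/

namespace IsCurve

variable {k K ι : Type*} [Field k] [Field K] [Algebra k K] {w : ι → Valuation K ℤᵐ⁰}
  (hC : IsCurve k w)
include hC

theorem exists_tame_of_not_isSquare_at_poles [CharP k 2] [PerfectField k] [CharP K 2] {a f : K}
    (ha : Transcendental k a) (hfin : FiniteDimensional k⟮a⟯ K)
    (hpole : ∀ x, 1 < w x a → ¬ IsSquare (w x f))
    (hodd : ∀ x, ∃ h, ¬ IsSquare (w x (f + h ^ 4)))
    (hunr : {x | ¬ UnramifiedAt (w x) f}.Finite) :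
    ∃ h d, ∀ x, TameAt k (w x) ((f + h ^ 4) ^ 3 + d ^ 4) := by
  classical
  have hSfin : {x | ¬ UnramifiedAt (w x) f ∧ w x a ≤ 1}.Finite := hunr.subset fun x hx => hx.1
  obtain ⟨S, hS⟩ : ∃ S : Finset ι, ∀ x, x ∈ S ↔ ¬ UnramifiedAt (w x) f ∧ w x a ≤ 1 :=
    ⟨hSfin.toFinset, fun x => by simp⟩
  obtain ⟨P, hP⟩ : ∃ P : Finset ι, ∀ x, x ∈ P ↔ 1 < w x a :=
    ⟨(hC.finite_one_lt a).toFinset, fun x => by simp⟩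
  choose t ht using hodd
  have ht0 : ∀ x, w x (f + t x ^ 4) ≠ 0 := fun x => ne_zero_of_not_isSquare (ht x)
  -- a bound for the errors at the points of `S`
  obtain ⟨N, hN⟩ : ∃ N : ℕ, ∀ x ∈ S, (exp (-1 : ℤ) ^ N) ^ 4 < w x (f + t x ^ 4) := by
    refine Filter.Eventually.exists (f := Filter.atTop) ?_
    rw [Filter.eventually_all_finset]
    intro x _
    have hlt : (exp (-1) : ℤᵐ⁰) ^ 4 < 1 := by
      rw [← exp_nsmul, ← exp_zero, exp_lt_exp]
      norm_num
    simpa only [← pow_mul, mul_comm] using eventually_pow_lt hlt (ht0 x)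
  obtain ⟨h₀, hh₀S, hh₀⟩ := hC.exists_forall_sub_lt_of_le_one ha S (fun x hx => ((hS x).1 hx).2) t
    (ε := fun _ => exp (-1) ^ N) (fun _ => pow_ne_zero _ exp_ne_zero)
  obtain ⟨p, hp, hpS⟩ := hC.exists_polynomial_lt_one S (a := a) fun x hx => ((hS x).1 hx).2
  obtain ⟨m, hm1, hm⟩ : ∃ m : ℕ, 1 ≤ m ∧ ∀ x ∈ S, (w x (aeval a p) ^ m) ^ 4 < w x (f + t x ^ 4) ∧
      (w x (aeval a p) ^ m) ^ 4 < w x (f + t x ^ 4) ^ 3 := by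
    refine Filter.Eventually.exists (f := Filter.atTop) ?_
    refine (Filter.eventually_ge_atTop 1).and ?_
    rw [Filter.eventually_all_finset]
    intro x hx
    have hlt : w x (aeval a p) ^ 4 < 1 := pow_lt_one₀ zero_le (hpS x hx) (by norm_num)
    have := (eventually_pow_lt hlt (ht0 x)).and (eventually_pow_lt hlt (pow_ne_zero 3 (ht0 x)))
    simpa only [← pow_mul, mul_comm] using this
  -- The function c has poles at the poles of a, is regular elsewhere, and is very small on `S`. It
  -- carries both corrections: cʲ enlarges h at the poles without disturbing it on `S`, and the
  -- second parameter is taken of the form c·d.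
  set c := aeval a (p ^ m) with hc
  have hcS : ∀ x ∈ S, w x c ^ 4 < w x (f + t x ^ 4) ∧ w x c ^ 4 < w x (f + t x ^ 4) ^ 3 :=
    fun x hx => by simpa only [hc, map_pow] using hm x hx
  have hc1 : ∀ x, w x a ≤ 1 → w x c ≤ 1 := fun x hx => (hC.isPlace x).map_aeval_le_one hx _
  have hcP : ∀ x, 1 < w x a → 1 < w x c := fun x hx => by
    rw [hc, hC.map_aeval_of_one_lt hx (pow_ne_zero _ (ne_zero_of_natDegree_gt hp))]
    refine one_lt_pow₀ hx ?_
    rw [natDegree_pow]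
    positivity
  have hc0 : c ≠ 0 := fun h => ha ⟨p ^ m, pow_ne_zero _ (ne_zero_of_natDegree_gt hp), h⟩
  obtain ⟨B, hB⟩ := hC.exists_bound hfin
  -- The bound `B` is uniform over the functions approximated, so j can be chosen after it, although
  -- d depends on h and hence on j.
  obtain ⟨j, hj1, hj⟩ : ∃ j : ℕ, 1 ≤ j ∧ ∀ x ∈ P, w x h₀ < w x c ^ j ∧ w x f < w x c ^ j ∧
      (w x c * B) ^ 4 * (w x f)⁻¹ < w x c ^ j := by
    refine Filter.Eventually.exists (f := Filter.atTop) ?_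
    refine (Filter.eventually_ge_atTop 1).and ?_
    rw [Filter.eventually_all_finset]
    intro x hx
    have := hcP x ((hP x).1 hx)
    exact (eventually_lt_pow _ this).and ((eventually_lt_pow _ this).and (eventually_lt_pow _ this))
  set h := h₀ + c ^ j with hh
  -- Approximating -h³/c makes h³ + c·d at most w(c)·B at the poles, while c·d stays small on `S`.
  obtain ⟨d, hd1, hdP⟩ := hB (-h ^ 3 / c)
  refine ⟨h, c * d, fun x => ?_⟩
  by_cases hxa : 1 < w x a
  · obtain ⟨hj1, hj2, hj3⟩ := hj x ((hP x).2 hxa)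
    have hwh : w x h = w x c ^ j := by
      rw [hh, (w x).map_add_eq_of_lt_right (by rwa [map_pow]), map_pow]
    have hh1 : 1 < w x h := by
      rw [hwh]
      exact one_lt_pow₀ (hcP x hxa) (by omega)
    rw [← hwh] at hj2 hj3
    have hf0 : w x f ≠ 0 := ne_zero_of_not_isSquare (hpole x hxa)
    have hfpos : 0 < w x f := zero_lt_iff.2 hf0
    have hhpos : 0 < w x h := zero_lt_one.trans hh1
    -- In characteristic 2, g = fh⁸ + f²h⁴ + f³ + (h³ + cd)⁴. The first term has odd order and
    -- dominates the others.
    have hmain : ¬ IsSquare (w x (f * h ^ 8)) := by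
      rw [map_mul, map_pow, show w x h ^ 8 = (w x h ^ 2) ^ 4 by rw [← pow_mul],
        isSquare_mul_pow_four_iff (pow_ne_zero 2 hhpos.ne')]
      exact hpole x hxa
    have hfh4 : w x f < w x h ^ 4 := hj2.trans_le (le_self_pow hh1.le (by norm_num))
    have e1 : w x (f ^ 2 * h ^ 4) < w x (f * h ^ 8) := by
      rw [map_mul, map_mul, map_pow, map_pow, map_pow]
      calc w x f ^ 2 * w x h ^ 4 = w x f * (w x f * w x h ^ 4) := by rw [pow_two, mul_assoc]
        _ < w x f * (w x h ^ 4 * w x h ^ 4) :=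
          mul_lt_mul_of_pos_left (mul_lt_mul_of_pos_right hfh4 (pow_pos hhpos 4)) hfpos
        _ = _ := by rw [← pow_add]
    have e2 : w x (f ^ 3) < w x (f * h ^ 8) := by
      refine lt_trans ?_ e1
      rw [map_mul, map_pow, map_pow, map_pow, pow_succ]
      exact mul_lt_mul_of_pos_left hfh4 (pow_pos hfpos 2)
    have e3 : w x ((h ^ 3 + c * d) ^ 4) < w x (f * h ^ 8) := by
      have h1 : w x (h ^ 3 + c * d) ≤ w x c * B := by
        have : h ^ 3 + c * d = c * (d - -h ^ 3 / c) := by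
          field_simp
          ring
        rw [this, map_mul]
        exact mul_le_mul_right (hdP x hxa) _
      rw [map_pow, map_mul, map_pow]
      refine (pow_le_pow_left' h1 4).trans_lt ?_
      have h2 : (w x c * B) ^ 4 < w x h * w x f := by
        rwa [← div_eq_mul_inv, div_lt_iff₀ hfpos] at hj3
      rw [mul_comm (w x f)]
      exact h2.trans_le (mul_le_mul_left (le_self_pow hh1.le (by norm_num)) _)
    refine (hC.isPlace x).tameAt_of_not_isSquare ?_
    have : (f + h ^ 4) ^ 3 + (c * d) ^ 4 =
        f * h ^ 8 + (f ^ 2 * h ^ 4 + f ^ 3 + (h ^ 3 + c * d) ^ 4) := by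
      rw [PseudotameCurve.add_pow_four (h ^ 3) (c * d)]
      linear_combination (f * h ^ 8 + f ^ 2 * h ^ 4) * CharTwo.two_eq_zero (R := K)
    rw [this, (w x).map_add_eq_of_lt_left]
    · exact hmain
    · exact (w x).map_add_lt ((w x).map_add_lt e1 e2) e3
  have hxa' : w x a ≤ 1 := not_lt.1 hxa
  have hcd : w x (c * d) ≤ w x c := by
    rw [map_mul]
    exact mul_le_of_le_one_right' (hd1 x hxa')
  by_cases hxS : x ∈ S
  · have hwf : w x (f + h ^ 4) = w x (f + t x ^ 4) := by
      have : f + h ^ 4 = (f + t x ^ 4) + ((h₀ - t x) ^ 4 + (c ^ j) ^ 4) := by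
        rw [hh, CharTwo.sub_eq_add, PseudotameCurve.add_pow_four, PseudotameCurve.add_pow_four]
        linear_combination (-t x ^ 4) * CharTwo.two_eq_zero (R := K)
      rw [this, (w x).map_add_eq_of_lt_left]
      refine (w x).map_add_lt ?_ ?_
      · rw [map_pow]
        exact pow_four_lt_of_le (hh₀S x hxS).le (hN x hxS)
      · rw [map_pow, map_pow]
        refine pow_four_lt_of_le ?_ (hcS x hxS).1
        exact pow_le_of_le_one zero_le (hc1 x hxa') (by omega)
    refine (hC.isPlace x).tameAt_of_not_isSquare ?_
    rw [(w x).map_add_eq_of_lt_left, map_pow, hwf]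
    · exact not_isSquare_pow_three (ht x)
    · rw [map_pow, map_pow, hwf]
      exact pow_four_lt_of_le hcd (hcS x hxS).2
  · have hunrx : UnramifiedAt (w x) f := by
      by_contra hcon
      exact hxS ((hS x).2 ⟨hcon, hxa'⟩)
    have hh1 : w x h ≤ 1 := by
      refine ((w x).map_add _ _).trans (max_le (hh₀ x hxa' hxS) ?_)
      rw [map_pow]
      exact pow_le_one' (hc1 x hxa') j
    exact (hC.isPlace x).tameAt_cube_add_of_unramifiedAt (hunrx.add_pow_four hh1)
      (hcd.trans (hc1 x hxa'))

/-- A function that has everywhere odd order up to fourth powers is made tame by a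
transformation `f ↦ (f + h⁴)³ + d⁴`. -/
theorem exists_tame [CharP k 2] [PerfectField k] [CharP K 2] {f : K}
    (hf : Transcendental k f) (hfin : FiniteDimensional k⟮f⟯ K)
    (hodd : ∀ x, ∃ h, ¬ IsSquare (w x (f + h ^ 4)))
    (hunr : {x | ¬ UnramifiedAt (w x) f}.Finite) :
    ∃ h d, ∀ x, TameAt k (w x) ((f + h ^ 4) ^ 3 + d ^ 4) := by
  choose t ht using hodd
  have hN : ∀ x, ∃ N : ℕ, (exp (-1 : ℤ) ^ N) ^ 4 < w x (f + t x ^ 4) := by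
    intro x
    refine Filter.Eventually.exists (f := Filter.atTop) ?_
    have hlt : (exp (-1) : ℤᵐ⁰) ^ 4 < 1 := by
      rw [← exp_nsmul, ← exp_zero, exp_lt_exp]
      norm_num
    simpa only [← pow_mul, mul_comm] using
      eventually_pow_lt hlt (ne_zero_of_not_isSquare (ht x))
  choose N hN using hN
  -- The first fourth power makes the order odd at the poles of the original f, which keeps the role
  -- of `a`.
  obtain ⟨h₀, hh₀⟩ := hC.exists_forall_sub_lt (hC.finite_one_lt f).toFinset t
    (ε := fun x => exp (-1) ^ N x) (fun _ => pow_ne_zero _ exp_ne_zero)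
  obtain ⟨h, d, hd⟩ := hC.exists_tame_of_not_isSquare_at_poles (f := f + h₀ ^ 4) hf hfin
    (fun x hx => by
      have : f + h₀ ^ 4 = (f + t x ^ 4) + (h₀ - t x) ^ 4 := by
        rw [CharTwo.sub_eq_add, PseudotameCurve.add_pow_four]
        linear_combination (-t x ^ 4) * CharTwo.two_eq_zero (R := K)
      rw [this, (w x).map_add_eq_of_lt_left]
      · exact ht x
      · rw [map_pow]
        exact pow_four_lt_of_le (hh₀ x (by simpa using hx)).le (hN x))
    (fun x => ⟨h₀ + t x, by
      have : f + h₀ ^ 4 + (h₀ + t x) ^ 4 = f + t x ^ 4 := by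
        rw [PseudotameCurve.add_pow_four]
        linear_combination h₀ ^ 4 * CharTwo.two_eq_zero (R := K)
      rw [this]
      exact ht x⟩)
    ((hunr.union (hC.finite_one_lt h₀)).subset fun x hx => by
      by_contra hcon
      simp only [Set.mem_union, Set.mem_ofPred_eq, not_or, not_not, not_lt] at hcon
      exact hx (hcon.1.add_pow_four hcon.2))
  refine ⟨h₀ + h, d, fun x => ?_⟩
  rw [PseudotameCurve.add_pow_four, ← add_assoc]
  exact hd x

end IsCurve

end PseudotameCurve

namespace PseudotameCurve

open Polynomial WithZero
open scoped IntermediateField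

/-! ### Smooth algebras of relative dimension one -/

section Etale

variable (k A : Type*) [Field k] [CommRing A] [Algebra k[X] A] [Algebra.Etale k[X] A]

theorem algebraMap_injective_of_etale [IsDomain A] : Function.Injective (algebraMap k[X] A) :=
  FaithfulSMul.algebraMap_injective k[X] A

include k in
-- At a nonzero prime, unramifiedness over k[X] makes the maximal ideal of the local ring the
-- extension of an ideal of a principal ideal domain, so it is principal.
theorem isDedekindDomain_of_etale [IsDomain A] : IsDedekindDomain A := by
  have : IsNoetherianRing A := Algebra.FiniteType.isNoetherianRing k[X] A
  have : IsDedekindDomainDvr A := by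
    refine { is_dvr_at_nonzero_prime := fun q hq hqp => ?_ }
    let p := q.under k[X]
    let := Localization.AtPrime.algebraOfLiesOver p q
    have hunr : Algebra.IsUnramifiedAt k[X] q :=
      Algebra.FormallyUnramified.comp _ A _
    have hmap := ((Algebra.isUnramifiedAt_iff_map_eq k[X] p q).1 hunr).2
    refine ((IsDiscreteValuationRing.TFAE (Localization.AtPrime q)
      (IsLocalization.AtPrime.not_isField A hq (Localization.AtPrime q))).out 4 0).mp ?_
    obtain ⟨g, hg⟩ := (IsPrincipalIdealRing.principal p).principal
    rw [← hmap, hg]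
    refine ⟨⟨algebraMap k[X] _ g, ?_⟩⟩
    rw [Ideal.submodule_span_eq, Ideal.submodule_span_eq, Ideal.map_span, Set.image_singleton]
  infer_instance

include k in
-- By Zariski's lemma a field of finite type over k is algebraic, but X maps to a transcendental
-- element.
theorem not_isField_of_etale [IsDomain A] : ¬ IsField A := by
  intro hA
  let := ((algebraMap k[X] A).comp (algebraMap k k[X])).toAlgebra
  have : IsScalarTower k k[X] A := IsScalarTower.of_algebraMap_eq' rfl
  let := hA.toField
  have : Algebra.FiniteType k A := Algebra.FiniteType.trans (S := k[X]) inferInstance inferInstance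
  have : Module.Finite k A := finite_of_finite_type_of_isJacobsonRing k A
  obtain ⟨p, hp, hp'⟩ := Algebra.IsAlgebraic.isAlgebraic (R := k) (algebraMap k[X] A X)
  rw [aeval_algebraMap_apply, aeval_X_left_apply] at hp'
  exact hp ((map_eq_zero_iff _ (algebraMap_injective_of_etale k A)).1 hp')

theorem finrank_kaehlerDifferential_of_etale [Algebra k A] [IsScalarTower k k[X] A] (K : Type*)
    [Field K] [Algebra A K] [Algebra k K] [IsScalarTower k A K] [IsFractionRing A K] : Module.finrank K Ω[K⁄k] = 1 := by
  let := ((algebraMap A K).comp (algebraMap k[X] A)).toAlgebra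
  have : IsScalarTower k[X] A K := IsScalarTower.of_algebraMap_eq' rfl
  have : IsScalarTower k k[X] K := IsScalarTower.of_algebraMap_eq' (by
    rw [IsScalarTower.algebraMap_eq k[X] A K, RingHom.comp_assoc,
      ← IsScalarTower.algebraMap_eq k k[X] A, ← IsScalarTower.algebraMap_eq k A K])
  have : Algebra.FormallyEtale A K := .of_isLocalization (nonZeroDivisors A)
  have : Algebra.FormallyEtale k[X] K := .comp k[X] A K
  let e := KaehlerDifferential.tensorKaehlerEquivOfFormallyEtale k k[X] K
  let e' := (KaehlerDifferential.polynomialEquiv k).baseChange k[X] K _ _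
  rw [← e.finrank_eq, e'.finrank_eq, Module.finrank_baseChange, Module.finrank_self]

end Etale

section StandardSmooth

variable (k A : Type*) [Field k] [CommRing A] [Algebra k A]
  [Algebra.IsStandardSmoothOfRelativeDimension 1 k A]

theorem exists_etale_polynomial_of_isStandardSmooth :
    ∃ _ : Algebra k[X] A, IsScalarTower k k[X] A ∧ Algebra.Etale k[X] A := by
  obtain ⟨g, hg⟩ :=
    Algebra.IsStandardSmoothOfRelativeDimension.exists_etale_mvPolynomial (n := 1) k A
  let e := (MvPolynomial.uniqueAlgEquiv k (Fin 1)).symm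
  let φ : k[X] →ₐ[k] A := g.comp e.toAlgHom
  algebraize [e.toAlgHom.toRingHom, g.toRingHom, φ.toRingHom]
  have : Algebra.Etale k[X] (MvPolynomial (Fin 1) k) :=
    RingHom.Etale.of_bijective (f := e.toAlgHom.toRingHom) e.bijective
  have : IsScalarTower k[X] (MvPolynomial (Fin 1) k) A := IsScalarTower.of_algebraMap_eq' rfl
  exact ⟨inferInstance, IsScalarTower.of_algebraMap_eq' φ.comp_algebraMap.symm,
    Algebra.Etale.comp k[X] (MvPolynomial (Fin 1) k) A⟩

include k in
theorem isDedekindDomain_of_isStandardSmooth [IsDomain A] : IsDedekindDomain A := by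
  obtain ⟨_, _, _⟩ := exists_etale_polynomial_of_isStandardSmooth k A
  exact isDedekindDomain_of_etale k A

include k in
theorem not_isField_of_isStandardSmooth [IsDomain A] : ¬ IsField A := by
  obtain ⟨_, _, _⟩ := exists_etale_polynomial_of_isStandardSmooth k A
  exact not_isField_of_etale k A

theorem finrank_kaehlerDifferential_of_isStandardSmooth (K : Type*) [Field K] [Algebra A K]
    [Algebra k K] [IsScalarTower k A K] [IsFractionRing A K] : Module.finrank K Ω[K⁄k] = 1 := by
  obtain ⟨_, _, _⟩ := exists_etale_polynomial_of_isStandardSmooth k A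
  exact finrank_kaehlerDifferential_of_etale k A K

end StandardSmooth

/-! ### Function fields in one variable -/

section FunctionField

variable {k K : Type*} [Field k] [Field K] [Algebra k K]

/-- Differentiating a separable minimal polynomial relation would force df = 0. -/
theorem transcendental_of_D_ne_zero [PerfectField k] {f : K}
    (hf : KaehlerDifferential.D k K f ≠ 0) : Transcendental k f := by
  intro halg
  have hint : IsIntegral k f := halg.isIntegral
  have hsep : (minpoly k f).Separable :=
    PerfectField.separable_of_irreducible (minpoly.irreducible hint)
  have h := (KaehlerDifferential.D k K).map_aeval (minpoly k f) f
  rw [minpoly.aeval, map_zero] at h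
  exact hf ((smul_eq_zero.1 h.symm).resolve_left (hsep.aeval_derivative_ne_zero (minpoly.aeval k f)))

/-- As df spans the one-dimensional Ω of K over k, the differentials over k(f) vanish. An
unramified, essentially finite type extension of fields is finite. -/
theorem finiteDimensional_adjoin_of_D_ne_zero [Algebra.EssFiniteType k K]
    (hrank : Module.finrank K Ω[K⁄k] = 1) {f : K} (hf : KaehlerDifferential.D k K f ≠ 0) :
    FiniteDimensional k⟮f⟯ K := by
  have : Algebra.EssFiniteType k⟮f⟯ K := .of_comp k k⟮f⟯ K
  have hsub : Subsingleton Ω[K⁄k⟮f⟯] := by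
    refine subsingleton_of_forall_eq 0 fun ω => ?_
    obtain ⟨η, rfl⟩ := KaehlerDifferential.map_surjective k k⟮f⟯ K ω
    obtain ⟨c, rfl⟩ := exists_smul_eq_of_finrank_eq_one hrank hf η
    rw [map_smul, KaehlerDifferential.map_D]
    have : (algebraMap K K f : K) =
        algebraMap k⟮f⟯ K ⟨f, IntermediateField.mem_adjoin_simple_self k f⟩ := rfl
    rw [this, Derivation.map_algebraMap, smul_zero]
  have : Algebra.FormallyUnramified k⟮f⟯ K := (Algebra.formallyUnramified_iff _ _).2 hsub
  exact Algebra.FormallyUnramified.finite_of_free k⟮f⟯ K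

theorem exists_derivation_ne_zero {f : K} (hf : KaehlerDifferential.D k K f ≠ 0) :
    ∃ D : Derivation k K K, D f ≠ 0 := by
  by_contra! h
  refine hf ((Module.forall_dual_apply_eq_zero_iff K _).1 fun φ => ?_)
  exact h (φ.compDer (KaehlerDifferential.D k K))

/-- In characteristic 2, D kills squares. If f + u⁴ = ϖ²b with b regular, then D f = ϖ²·D b is not a
unit. -/
theorem IsPlace.unramifiedAt_of_derivation [CharP K 2] {w : Valuation K ℤᵐ⁰} (hw : IsPlace k w)
    {D : Derivation k K K} (hD : ∀ a, w a ≤ 1 → w (D a) ≤ 1) {f : K} (hf : w f ≤ 1)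
    (hDf : w (D f) = 1) : UnramifiedAt w f := by
  obtain ⟨u, hu, huf⟩ := hw.exists_pow_four f hf
  refine ⟨hf, u, hu, le_antisymm ?_ ?_⟩
  · have := le_exp_sub_one_of_lt (n := 0) (by simpa using huf)
    simpa using this
  · by_contra! hlt
    have hle := le_exp_sub_one_of_lt hlt
    obtain ⟨ϖ, hϖ⟩ := hw.exists_uniformizer
    have hϖ0 : ϖ ≠ 0 := by
      rintro rfl
      rw [map_zero] at hϖ
      exact exp_ne_zero hϖ.symm
    have hϖ2 : w (ϖ ^ 2) = exp (-1 - 1) := by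
      rw [map_pow, hϖ, ← exp_nsmul]
      rfl
    set b := (f + u ^ 4) / ϖ ^ 2 with hb
    have hb1 : w b ≤ 1 := by
      rw [hb, map_div₀, hϖ2]
      exact div_le_one_of_le₀ hle zero_le
    have hfb : f + u ^ 4 = ϖ ^ 2 * b := by
      rw [hb]
      field_simp
    have hDeq : D f = ϖ ^ 2 * D b := by
      have h := congrArg D hfb
      rw [map_add, Derivation.leibniz, Derivation.leibniz_pow, Derivation.leibniz_pow] at h
      simp only [smul_eq_mul, nsmul_eq_mul] at h
      push_cast at h
      linear_combination h + (b * ϖ * D ϖ - 2 * u ^ 3 * D u) * CharTwo.two_eq_zero (R := K)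
    have : w (D f) < 1 := by
      rw [hDeq, map_mul, hϖ2]
      refine mul_lt_one_of_lt_of_le ?_ (hD b hb1)
      rw [← exp_zero, exp_lt_exp]
      norm_num
    exact this.ne hDf

end FunctionField

/-! ### Places from discrete valuation rings -/

section LocalRing

variable {k K : Type*} [Field k] [Field K] [Algebra k K]

/-- The residue field is algebraic over a perfect field, hence perfect, so the square of Frobenius
is onto. Minimal polynomials of residues supply the irreducible polynomials. -/
theorem isPlace_maximalIdeal [CharP k 2] [PerfectField k] [CharP K 2] (R : Type*) [CommRing R]
    [IsDomain R] [IsDiscreteValuationRing R] [Algebra R K] [IsFractionRing R K] [Algebra k R]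
    [IsScalarTower k R K] [Algebra.IsAlgebraic k (IsLocalRing.ResidueField R)] :
    IsPlace k ((IsDiscreteValuationRing.maximalIdeal R).valuation K) := by
  have hlt : ∀ r : R, (IsDiscreteValuationRing.maximalIdeal R).valuation K (algebraMap R K r) < 1 ↔
      IsLocalRing.residue R r = 0 := fun r => by
    rw [IsDedekindDomain.HeightOneSpectrum.valuation_lt_one_iff_mem, IsLocalRing.residue_eq_zero_iff]
    rfl
  refine ⟨IsDedekindDomain.HeightOneSpectrum.valuation_exists_uniformizer K _, fun c => ?_,
    fun a ha => ?_, fun a ha => ?_⟩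
  · rw [IsScalarTower.algebraMap_apply k R K]
    exact IsDedekindDomain.HeightOneSpectrum.valuation_le_one _ _
  · obtain ⟨r, rfl⟩ := IsDiscreteValuationRing.exists_lift_of_le_one ha
    have hint : IsIntegral k (IsLocalRing.residue R r) :=
      (Algebra.IsAlgebraic.isAlgebraic (R := k) _).isIntegral
    refine ⟨minpoly k (IsLocalRing.residue R r), minpoly.irreducible hint, ?_⟩
    rw [aeval_algebraMap_apply, hlt]
    have := minpoly.aeval k (IsLocalRing.residue R r)
    rwa [← IsLocalRing.ResidueField.algebraMap_eq, aeval_algebraMap_apply] at this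
  · obtain ⟨r, rfl⟩ := IsDiscreteValuationRing.exists_lift_of_le_one ha
    have : PerfectField (IsLocalRing.ResidueField R) := Algebra.IsAlgebraic.perfectField k
    have : CharP (IsLocalRing.ResidueField R) 2 :=
      charP_of_injective_algebraMap (algebraMap k (IsLocalRing.ResidueField R)).injective 2
    have : PerfectRing (IsLocalRing.ResidueField R) 2 := PerfectField.toPerfectRing 2
    obtain ⟨e, he⟩ := (iterateFrobeniusEquiv (IsLocalRing.ResidueField R) 2 2).surjective
      (IsLocalRing.residue R r)
    obtain ⟨s, rfl⟩ := IsLocalRing.residue_surjective e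
    rw [iterateFrobeniusEquiv_apply, iterateFrobenius_def] at he
    refine ⟨algebraMap R K s, IsDedekindDomain.HeightOneSpectrum.valuation_le_one _ _, ?_⟩
    rw [← map_pow, ← map_add, hlt, map_add, map_pow, ← he]
    exact CharTwo.add_self_eq_zero _

theorem isAlgebraic_residueField (A : Type*) [CommRing A] [Algebra k A] [Algebra.FiniteType k A]
    (q : Ideal A) [q.IsMaximal] (S : Type*) [CommRing S] [IsLocalRing S] [Algebra A S]
    [IsLocalization.AtPrime S q] [Algebra k S] [IsScalarTower k A S] :
    Algebra.IsAlgebraic k (IsLocalRing.ResidueField S) := by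
  have hsurj : Function.Surjective (algebraMap A (IsLocalRing.ResidueField S)) := by
    intro y
    obtain ⟨s, rfl⟩ := IsLocalRing.residue_surjective y
    obtain ⟨a, ha⟩ := (IsLocalization.AtPrime.equivQuotMaximalIdeal q S).surjective
      (Ideal.Quotient.mk _ s)
    obtain ⟨a, rfl⟩ := Ideal.Quotient.mk_surjective a
    refine ⟨a, ?_⟩
    rw [IsScalarTower.algebraMap_apply A S, IsLocalRing.ResidueField.algebraMap_eq]
    rw [IsLocalization.AtPrime.equivQuotMaximalIdeal_apply_mk] at ha
    exact ha
  have : Algebra.FiniteType k (IsLocalRing.ResidueField S) :=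
    Algebra.FiniteType.of_surjective
      (IsScalarTower.toAlgHom k A (IsLocalRing.ResidueField S)) hsurj
  have := finite_of_finite_type_of_isJacobsonRing k (IsLocalRing.ResidueField S)
  infer_instance

end LocalRing

end PseudotameCurve

namespace PseudotameCurve

open WithZero

/-! ### The closed points of a smooth curve -/

noncomputable section

variable {k : Type u} [Field k] {X : Scheme.{u}} (π : X ⟶ Spec (.of k))

/-- The structure map `k → Γ(X, V)`. -/
def sectionMap (V : X.Opens) : k →+* Γ(X, V) :=
  ((Scheme.ΓSpecIso (.of k)).inv ≫ π.appLE ⊤ V le_top).hom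

/-- The sections over an open subset as a `k`-algebra. -/
abbrev sectionAlgebra (V : X.Opens) : Algebra k Γ(X, V) := (sectionMap π V).toAlgebra

/-- The local rings as `k`-algebras. -/
abbrev stalkAlgebra (x : X) : Algebra k (X.presheaf.stalk x) :=
  ((Scheme.ΓSpecIso (.of k)).inv ≫ π.appTop ≫ X.presheaf.germ ⊤ x trivial).hom.toAlgebra

theorem germ_sectionMap (V : X.Opens) (x : X) (hx : x ∈ V) (c : k) :
    X.presheaf.germ V x hx (sectionMap π V c) =
      ((Scheme.ΓSpecIso (.of k)).inv ≫ π.appTop ≫ X.presheaf.germ ⊤ x trivial).hom c := by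
  have : π.appTop ≫ X.presheaf.germ ⊤ x trivial = π.appLE ⊤ V le_top ≫ X.presheaf.germ V x hx := by
    have h : π.appLE ⊤ V le_top = π.appTop ≫ X.presheaf.map (homOfLE le_top).op := rfl
    rw [h, Category.assoc, X.presheaf.germ_res (homOfLE le_top) x hx]
  rw [this]
  rfl

theorem isScalarTower_section_stalk (V : X.Opens) (x : V) :
    letI := sectionAlgebra π V
    letI := stalkAlgebra π x
    IsScalarTower k Γ(X, V) (X.presheaf.stalk (x : X)) :=
  letI := sectionAlgebra π V
  letI := stalkAlgebra π x
  IsScalarTower.of_algebraMap_eq fun c => (germ_sectionMap π V x x.2 c).symm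

theorem exists_chart [SmoothOfRelativeDimension 1 π] (x : X) :
    ∃ V : X.Opens, x ∈ V ∧ IsAffineOpen V ∧
      letI := sectionAlgebra π V
      Algebra.IsStandardSmoothOfRelativeDimension 1 k Γ(X, V) := by
  obtain ⟨U, hU, V, hV, hx, e, h⟩ :=
    SmoothOfRelativeDimension.exists_isStandardSmoothOfRelativeDimension (n := 1) (f := π) x
  refine ⟨V, hx, hV, ?_⟩
  -- `Spec k` has a single point.
  obtain rfl : U = ⊤ := by
    refine top_le_iff.1 fun y _ => ?_
    rw [Subsingleton.elim y (π x)]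
    exact e hx
  exact (RingHom.isStandardSmoothOfRelativeDimension_respectsIso (n := 1)).2 _
    (Scheme.ΓSpecIso (.of k)).symm.commRingCatIsoToRingEquiv h

theorem finite_setOf_of_locally [CompactSpace X] {P : {x : X // IsClosed {x}} → Prop}
    (h : ∀ y : X, ∃ V : X.Opens, y ∈ V ∧ {x | x.1 ∈ V ∧ P x}.Finite) : {x | P x}.Finite := by
  choose V hV hfin using h
  obtain ⟨T, hT⟩ := isCompact_univ.elim_finite_subcover (fun y => (V y : Set X))
    (fun y => (V y).isOpen) fun y _ => Set.mem_iUnion.2 ⟨y, hV y⟩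
  refine (T.finite_toSet.biUnion fun y _ => hfin y).subset fun x hx => ?_
  obtain ⟨y, hy, hxy⟩ := Set.mem_iUnion₂.1 (hT (Set.mem_univ x.1))
  exact Set.mem_biUnion hy ⟨hxy, hx⟩

variable [IsIntegral X]

theorem isScalarTower_section_functionField (V : X.Opens) [Nonempty V] :
    letI := sectionAlgebra π V
    letI := functionFieldAlgebra π
    IsScalarTower k Γ(X, V) X.functionField :=
  letI := sectionAlgebra π V
  letI := functionFieldAlgebra π
  IsScalarTower.of_algebraMap_eq fun c => (germ_sectionMap π V _ _ c).symm

theorem isScalarTower_stalk_functionField (x : X) :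
    letI := stalkAlgebra π x
    letI := functionFieldAlgebra π
    IsScalarTower k (X.presheaf.stalk x) X.functionField :=
  letI := stalkAlgebra π x
  letI := functionFieldAlgebra π
  have h := X.presheaf.germ_stalkSpecializes (U := ⊤) (y := x) trivial
    ((genericPoint_spec X).specializes trivial)
  IsScalarTower.of_algebraMap_eq fun c => congrArg (fun g => ((Scheme.ΓSpecIso (.of k)).inv ≫
    π.appTop ≫ g).hom c) h.symm

theorem isDiscreteValuationRing_stalk [SmoothOfRelativeDimension 1 π] {x : X}
    (hx : IsClosed {x}) : IsDiscreteValuationRing (X.presheaf.stalk x) := by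
  obtain ⟨V, hxV, hV, hsm⟩ := exists_chart π x
  let := sectionAlgebra π V
  have : Nonempty V := ⟨⟨x, hxV⟩⟩
  have := isDedekindDomain_of_isStandardSmooth k Γ(X, V)
  have hmax := hV.primeIdealOf_isMaximal_of_isClosed ⟨x, hxV⟩ hx
  let := TopCat.Presheaf.algebra_section_stalk X.presheaf (⟨x, hxV⟩ : V)
  have := hV.isLocalization_stalk ⟨x, hxV⟩
  exact IsLocalization.AtPrime.isDiscreteValuationRing_of_dedekind_domain Γ(X, V)
    (Ring.ne_bot_of_isMaximal_of_not_isField hmax (not_isField_of_isStandardSmooth k Γ(X, V)))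
    (X.presheaf.stalk ((⟨x, hxV⟩ : V) : X))

/-- The valuation of the function field at a closed point. -/
def closedPointValuation [SmoothOfRelativeDimension 1 π] (x : {x : X // IsClosed {x}}) :
    Valuation X.functionField ℤᵐ⁰ :=
  haveI := isDiscreteValuationRing_stalk π x.2
  (IsDiscreteValuationRing.maximalIdeal (X.presheaf.stalk x.1)).valuation X.functionField

section

variable [SmoothOfRelativeDimension 1 π] (x : {x : X // IsClosed {x}})

theorem closedPointValuation_le_one_iff (a : X.functionField) :
    closedPointValuation π x a ≤ 1 ↔ ∃ r, algebraMap (X.presheaf.stalk x.1) X.functionField r = a := by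
  have := isDiscreteValuationRing_stalk π x.2
  constructor
  · exact fun h => IsDiscreteValuationRing.exists_lift_of_le_one h
  · rintro ⟨r, rfl⟩
    exact IsDedekindDomain.HeightOneSpectrum.valuation_le_one _ _

theorem closedPointValuation_lt_one_iff (r : X.presheaf.stalk x.1) :
    closedPointValuation π x (algebraMap _ X.functionField r) < 1 ↔
      r ∈ IsLocalRing.maximalIdeal (X.presheaf.stalk x.1) := by
  have := isDiscreteValuationRing_stalk π x.2
  exact IsDedekindDomain.HeightOneSpectrum.valuation_lt_one_iff_mem _ _

theorem closedPointValuation_section_le_one (V : X.Opens) [Nonempty V] (hx : x.1 ∈ V) (r : Γ(X, V)) :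
    closedPointValuation π x (algebraMap _ X.functionField r) ≤ 1 := by
  rw [closedPointValuation_le_one_iff]
  exact ⟨X.presheaf.germ V x.1 hx r, Scheme.algebraMap_germ_eq_germToFunctionField X hx r⟩

theorem closedPointValuation_section_lt_one_iff {V : X.Opens} [Nonempty V] (hV : IsAffineOpen V)
    (hx : x.1 ∈ V) (r : Γ(X, V)) :
    closedPointValuation π x (algebraMap _ X.functionField r) < 1 ↔
      r ∈ (hV.primeIdealOf ⟨x.1, hx⟩).asIdeal := by
  let : Algebra Γ(X, V) (X.presheaf.stalk x.1) :=
    TopCat.Presheaf.algebra_section_stalk X.presheaf (⟨x.1, hx⟩ : V)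
  have := hV.isLocalization_stalk ⟨x.1, hx⟩
  rw [← IsLocalization.AtPrime.to_map_mem_maximal_iff (X.presheaf.stalk x.1)
    (hV.primeIdealOf ⟨x.1, hx⟩).asIdeal r, ← closedPointValuation_lt_one_iff π]
  have h := Scheme.algebraMap_germ_eq_germToFunctionField X hx r
  exact h ▸ Iff.rfl

theorem isPlace_closedPointValuation [CharP k 2] [PerfectField k] :
    letI := functionFieldAlgebra π
    IsPlace k (closedPointValuation π x) := by
  let := functionFieldAlgebra π
  let := stalkAlgebra π x.1
  have := isScalarTower_stalk_functionField π x.1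
  have := isDiscreteValuationRing_stalk π x.2
  obtain ⟨V, hxV, hV, hsm⟩ := exists_chart π x.1
  let := sectionAlgebra π V
  have := isScalarTower_section_stalk π V ⟨x.1, hxV⟩
  have hmax := hV.primeIdealOf_isMaximal_of_isClosed ⟨x.1, hxV⟩ x.2
  let := TopCat.Presheaf.algebra_section_stalk X.presheaf (⟨x.1, hxV⟩ : V)
  have := hV.isLocalization_stalk ⟨x.1, hxV⟩
  have : Algebra.IsStandardSmooth k Γ(X, V) := hsm.isStandardSmooth
  have : Algebra.IsAlgebraic k (IsLocalRing.ResidueField (X.presheaf.stalk x.1)) :=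
    isAlgebraic_residueField Γ(X, V) (hV.primeIdealOf ⟨x.1, hxV⟩).asIdeal
      (X.presheaf.stalk ((⟨x.1, hxV⟩ : V) : X))
  have : CharP X.functionField 2 :=
    charP_of_injective_algebraMap (algebraMap k X.functionField).injective 2
  exact isPlace_maximalIdeal (X.presheaf.stalk x.1)

end

/-- On an affine chart a = α/β, and a point where a is not a unit gives one of the finitely many
prime divisors of the ideal (αβ) in a Dedekind domain. -/
theorem finite_closedPointValuation_ne_one [SmoothOfRelativeDimension 1 π] [CompactSpace X]
    {a : X.functionField} (ha : a ≠ 0) : {x | closedPointValuation π x a ≠ 1}.Finite := by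
  refine finite_setOf_of_locally fun y => ?_
  obtain ⟨V, hyV, hV, hsm⟩ := exists_chart π y
  refine ⟨V, hyV, ?_⟩
  let := sectionAlgebra π V
  have : Nonempty V := ⟨⟨y, hyV⟩⟩
  have := isDedekindDomain_of_isStandardSmooth k Γ(X, V)
  have := functionField_isFractionRing_of_isAffineOpen X V hV
  obtain ⟨α, β, hβ, rfl⟩ := IsFractionRing.div_surjective (A := Γ(X, V)) a
  have hβ0 : β ≠ 0 := nonZeroDivisors.ne_zero hβ
  have hα0 : α ≠ 0 := by
    rintro rfl
    simp at ha
  have hfin := Ideal.finite_factors (I := Ideal.span {α * β}) (by simp [hα0, hβ0])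
  refine ((hfin.image fun v => hV.fromSpec ⟨v.asIdeal, v.isPrime⟩).preimage
    Subtype.val_injective.injOn).subset ?_
  rintro x ⟨hxV, hx⟩
  have hmax := hV.primeIdealOf_isMaximal_of_isClosed ⟨x.1, hxV⟩ x.2
  refine ⟨⟨(hV.primeIdealOf ⟨x.1, hxV⟩).asIdeal, inferInstance,
    Ring.ne_bot_of_isMaximal_of_not_isField hmax (not_isField_of_isStandardSmooth k Γ(X, V))⟩,
    ?_, hV.fromSpec_primeIdealOf ⟨x.1, hxV⟩⟩
  simp only [Set.mem_ofPred_eq, Ideal.dvd_span_singleton]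
  by_contra hnot
  rw [hmax.isPrime.mul_mem_iff_mem_or_mem, not_or,
    ← closedPointValuation_section_lt_one_iff π x hV hxV,
    ← closedPointValuation_section_lt_one_iff π x hV hxV, not_lt, not_lt] at hnot
  refine hx ?_
  rw [map_div₀, le_antisymm (closedPointValuation_section_le_one π x V hxV α) hnot.1,
    le_antisymm (closedPointValuation_section_le_one π x V hxV β) hnot.2, div_one]

/-- The coordinate ring of a chart has finitely many generators, whose derivatives have finitely
many poles. Elsewhere the product and quotient rules carry regularity to the whole local ring. -/
theorem finite_not_derivation_stable [SmoothOfRelativeDimension 1 π] [CompactSpace X]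
    [CharP k 2] [PerfectField k] :
    letI := functionFieldAlgebra π
    ∀ D : Derivation k X.functionField X.functionField,
      {x | ¬ ∀ a, closedPointValuation π x a ≤ 1 → closedPointValuation π x (D a) ≤ 1}.Finite := by
  let := functionFieldAlgebra π
  intro D
  refine finite_setOf_of_locally fun y => ?_
  obtain ⟨V, hyV, hV, hsm⟩ := exists_chart π y
  refine ⟨V, hyV, ?_⟩
  let := sectionAlgebra π V
  have : Nonempty V := ⟨⟨y, hyV⟩⟩
  have := isScalarTower_section_functionField π V
  have := functionField_isFractionRing_of_isAffineOpen X V hV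
  have : Algebra.IsStandardSmooth k Γ(X, V) := hsm.isStandardSmooth
  obtain ⟨s, hs⟩ := (inferInstance : Algebra.FiniteType k Γ(X, V)).out
  have hfin : (⋃ r ∈ s, {x | 1 < closedPointValuation π x
      (D (algebraMap Γ(X, V) X.functionField r))}).Finite := by
    refine s.finite_toSet.biUnion fun r _ => ?_
    by_cases h0 : D (algebraMap Γ(X, V) X.functionField r) = 0
    · simp [h0]
    · exact (finite_closedPointValuation_ne_one π h0).subset fun x hx => ne_of_gt hx
  refine hfin.subset ?_
  rintro x ⟨hxV, hx⟩
  by_contra hnot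
  simp only [Set.mem_iUnion, Set.mem_ofPred_eq, not_exists, not_lt] at hnot
  have hsec : ∀ r : Γ(X, V), closedPointValuation π x (D (algebraMap _ X.functionField r)) ≤ 1 := by
    intro r
    have hr : r ∈ Algebra.adjoin k (s : Set Γ(X, V)) := hs ▸ Algebra.mem_top
    induction hr using Algebra.adjoin_induction with
    | mem r hr => exact hnot r hr
    | algebraMap c =>
      rw [← IsScalarTower.algebraMap_apply, D.map_algebraMap, map_zero]
      exact zero_le
    | add r t _ _ hr ht =>
      rw [map_add, map_add]
      exact ((closedPointValuation π x).map_add _ _).trans (max_le hr ht)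
    | mul r t _ _ hr ht =>
      rw [map_mul, D.leibniz, smul_eq_mul, smul_eq_mul]
      refine ((closedPointValuation π x).map_add _ _).trans (max_le ?_ ?_)
      · rw [map_mul]
        exact mul_le_one' (closedPointValuation_section_le_one π x V hxV r) ht
      · rw [map_mul]
        exact mul_le_one' (closedPointValuation_section_le_one π x V hxV t) hr
  refine hx fun a ha => ?_
  obtain ⟨r, rfl⟩ := (closedPointValuation_le_one_iff π x a).1 ha
  let := TopCat.Presheaf.algebra_section_stalk X.presheaf (⟨x.1, hxV⟩ : V)
  have := hV.isLocalization_stalk ⟨x.1, hxV⟩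
  obtain ⟨⟨α, β⟩, hαβ⟩ := IsLocalization.surj
    (hV.primeIdealOf ⟨x.1, hxV⟩).asIdeal.primeCompl (S := X.presheaf.stalk ((⟨x.1, hxV⟩ : V) : X)) r
  have hβ : closedPointValuation π x (algebraMap Γ(X, V) X.functionField β) = 1 := by
    refine le_antisymm (closedPointValuation_section_le_one π x V hxV _) (not_lt.1 ?_)
    rw [closedPointValuation_section_lt_one_iff π x hV hxV]
    exact β.2
  have hβ0 : algebraMap Γ(X, V) X.functionField β ≠ 0 := by
    intro h0
    rw [h0, map_zero] at hβ
    exact zero_ne_one hβ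
  have heq : algebraMap (X.presheaf.stalk x.1) X.functionField r =
      algebraMap Γ(X, V) X.functionField α / algebraMap Γ(X, V) X.functionField β := by
    rw [eq_div_iff hβ0]
    have := congrArg (algebraMap (X.presheaf.stalk x.1) X.functionField) hαβ
    rw [map_mul] at this
    have h1 := Scheme.algebraMap_germ_eq_germToFunctionField X hxV α
    have h2 := Scheme.algebraMap_germ_eq_germToFunctionField X hxV (β : Γ(X, V))
    exact (h2 ▸ this).trans h1
  rw [heq, Derivation.leibniz_div, smul_eq_mul, smul_eq_mul, smul_eq_mul, map_mul, map_pow, map_inv₀,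
    hβ, inv_one, one_pow, one_mul]
  refine ((closedPointValuation π x).map_sub _ _).trans (max_le ?_ ?_)
  · rw [map_mul]
    exact mul_le_one' hβ.le (hsec α)
  · rw [map_mul]
    exact mul_le_one' (closedPointValuation_section_le_one π x V hxV α) (hsec β)

theorem finite_not_unramifiedAt [SmoothOfRelativeDimension 1 π] [CompactSpace X]
    [CharP k 2] [PerfectField k] {f : X.functionField} (hf : f ∈ separableMorphisms π) :
    {x | ¬ UnramifiedAt (closedPointValuation π x) f}.Finite := by
  let := functionFieldAlgebra π
  have : CharP X.functionField 2 :=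
    charP_of_injective_algebraMap (algebraMap k X.functionField).injective 2
  obtain ⟨D, hD⟩ := exists_derivation_ne_zero (k := k) (K := X.functionField) hf
  have hf0 : f ≠ 0 := by
    rintro rfl
    simp at hD
  refine (((finite_closedPointValuation_ne_one π hD).union
    (finite_closedPointValuation_ne_one π hf0)).union
    (finite_not_derivation_stable π D)).subset fun x hx => ?_
  by_contra hnot
  simp only [Set.mem_union, Set.mem_ofPred_eq, not_or, not_not] at hnot
  exact hx ((isPlace_closedPointValuation π x).unramifiedAt_of_derivation hnot.2 hnot.1.2.le
    hnot.1.1)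

/-- If the local ring at x were contained in that at y inside K, then Spec 𝒪_y would map to X both
directly and through Spec 𝒪_x. The two maps agree at the dense generic point, so separatedness makes
them equal. Then y specializes to x, and y is closed. -/
theorem exists_closedPointValuation_le_one_one_lt [SmoothOfRelativeDimension 1 π] [IsSeparated π]
    {x y : {x : X // IsClosed {x}}} (hxy : x ≠ y) :
    ∃ a, closedPointValuation π x a ≤ 1 ∧ 1 < closedPointValuation π y a := by
  by_contra! hle
  refine hxy (Subtype.ext ?_)
  let φ : ∀ z : X, X.presheaf.stalk z →+* X.functionField := fun z => algebraMap _ _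
  have hmem : ∀ r, φ x.1 r ∈ (φ y.1).range := fun r =>
    (closedPointValuation_le_one_iff π y _).1
      (hle _ ((closedPointValuation_le_one_iff π x _).2 ⟨r, rfl⟩))
  let e : X.presheaf.stalk y.1 ≃+* (φ y.1).range :=
    RingEquiv.ofBijective (φ y.1).rangeRestrict
      ⟨fun a b h => IsFractionRing.injective (X.presheaf.stalk y.1) X.functionField
        (congrArg Subtype.val h), (φ y.1).rangeRestrict_surjective⟩
  let ψ : X.presheaf.stalk x.1 →+* X.presheaf.stalk y.1 :=
    e.symm.toRingHom.comp ((φ x.1).codRestrict (φ y.1).range hmem)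
  have hψ : (φ y.1).comp ψ = φ x.1 := by
    ext r
    exact congrArg Subtype.val (e.apply_symm_apply _)
  have hs : ∀ z : X, genericPoint X ⤳ z := fun z => (genericPoint_spec X).specializes trivial
  let i := Spec.map (X.presheaf.stalkSpecializes (hs y.1))
  let Ψ : X.presheaf.stalk x.1 ⟶ X.presheaf.stalk y.1 := CommRingCat.ofHom ψ
  have hcomp : Ψ ≫ X.presheaf.stalkSpecializes (hs y.1) =
      X.presheaf.stalkSpecializes (hs x.1) := CommRingCat.hom_ext hψ
  have hinj : Function.Injective (X.presheaf.stalkSpecializes (hs y.1)).hom :=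
    IsFractionRing.injective (X.presheaf.stalk y.1) X.functionField
  have hi : IsDominant i := by
    refine ⟨(PrimeSpectrum.denseRange_comap_iff_ker_le_nilRadical _).2 ?_⟩
    rw [(RingHom.injective_iff_ker_eq_bot _).1 hinj]
    exact bot_le
  have h1 : i ≫ X.fromSpecStalk y.1 = i ≫ Spec.map Ψ ≫ X.fromSpecStalk x.1 := by
    rw [← Category.assoc, ← Spec.map_comp, hcomp, Scheme.SpecMap_stalkSpecializes_fromSpecStalk,
      Scheme.SpecMap_stalkSpecializes_fromSpecStalk]
  have h2 : X.fromSpecStalk y.1 ≫ π =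
      (Spec.map Ψ ≫ X.fromSpecStalk x.1) ≫ π := by
    refine ext_of_isDominant i ?_
    rw [← Category.assoc, h1]
    simp only [Category.assoc]
  have h3 := ext_of_isDominant_of_isSeparated π h2 i h1
  have hspec : y.1 ⤳ x.1 := by
    have : y.1 ∈ Set.range (X.fromSpecStalk x.1) := by
      obtain ⟨z, hz⟩ : y.1 ∈ Set.range (X.fromSpecStalk y.1) := by
        rw [Scheme.range_fromSpecStalk]
        exact specializes_rfl
      refine ⟨Spec.map Ψ z, ?_⟩
      rw [← Scheme.Hom.comp_apply, ← h3, hz]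
    rwa [Scheme.range_fromSpecStalk] at this
  have := hspec.mem_closed y.2 rfl
  exact this

theorem isCurve_closedPointValuation [SmoothOfRelativeDimension 1 π] [IsSeparated π]
    [CompactSpace X] [CharP k 2] [PerfectField k] :
    letI := functionFieldAlgebra π
    IsCurve k (closedPointValuation π) :=
  letI := functionFieldAlgebra π
  ⟨fun x => isPlace_closedPointValuation π x, fun _ ha => finite_closedPointValuation_ne_one π ha,
    fun _ _ hxy => exists_closedPointValuation_le_one_one_lt π hxy⟩

theorem transcendental_of_mem_separableMorphisms [PerfectField k] {f : X.functionField}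
    (hf : f ∈ separableMorphisms π) :
    letI := functionFieldAlgebra π
    Transcendental k f :=
  letI := functionFieldAlgebra π
  transcendental_of_D_ne_zero hf

theorem finiteDimensional_of_mem_separableMorphisms [SmoothOfRelativeDimension 1 π]
    {f : X.functionField} (hf : f ∈ separableMorphisms π) :
    letI := functionFieldAlgebra π
    FiniteDimensional (IntermediateField.adjoin k {f}) X.functionField := by
  let := functionFieldAlgebra π
  obtain ⟨V, hxV, hV, hsm⟩ := exists_chart π (genericPoint X)
  let := sectionAlgebra π V
  have : Nonempty V := ⟨⟨_, hxV⟩⟩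
  have := isScalarTower_section_functionField π V
  have := functionField_isFractionRing_of_isAffineOpen X V hV
  have : Algebra.IsStandardSmooth k Γ(X, V) := hsm.isStandardSmooth
  have : Algebra.EssFiniteType Γ(X, V) X.functionField :=
    .of_isLocalization _ (nonZeroDivisors Γ(X, V))
  have : Algebra.EssFiniteType k X.functionField := .comp k Γ(X, V) X.functionField
  exact finiteDimensional_adjoin_of_D_ne_zero
    (finrank_kaehlerDifferential_of_isStandardSmooth k Γ(X, V) X.functionField) hf

end

end PseudotameCurve

namespace PseudotameCurve

open WithZero IntermediateField

/-! ### Tameness and pseudotameness in terms of valuations -/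

/-- An element of least positive order at `w` in `k(f)`. -/
def IsGeneratorAt (k : Type*) {K : Type*} [Field k] [Field K] [Algebra k K]
    (w : Valuation K ℤᵐ⁰) (f t : K) : Prop :=
  t ∈ k⟮f⟯ ∧ w t < 1 ∧ ∀ s ∈ k⟮f⟯, w s < 1 → w s ≤ w t

theorem IsPlace.exists_isGeneratorAt {k K : Type*} [Field k] [Field K] [Algebra k K]
    {w : Valuation K ℤᵐ⁰} (hw : IsPlace k w) {f : K} (hf : Transcendental k f) :
    ∃ t, t ≠ 0 ∧ IsGeneratorAt k w f t := by
  wlog hf1 : w f ≤ 1 generalizing f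
  · obtain ⟨t, ht0, ht⟩ := this (f := f⁻¹) (fun h => hf (by simpa using h.inv))
      (by rw [map_inv₀]; exact (inv_lt_one_of_one_lt₀ (not_le.1 hf1)).le)
    rw [IsGeneratorAt, adjoin_inv_eq] at ht
    exact ⟨t, ht0, ht⟩
  obtain ⟨P, hirr, hP, hP0⟩ := hw.exists_generator hf hf1
  exact ⟨_, hP0, aeval_mem_adjoin f P, hP, fun s hs hs1 =>
    hw.map_le_of_mem_adjoin hf1 hirr hP hP0 hs hs1⟩

noncomputable section

variable {k : Type u} [Field k] {X : Scheme.{u}} [IsIntegral X] (π : X ⟶ Spec (.of k))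
  [SmoothOfRelativeDimension 1 π] (x : {x : X // IsClosed {x}})

theorem closedPointValuation_le_exp_iff (r : X.presheaf.stalk x.1) (n : ℕ) :
    closedPointValuation π x (algebraMap _ X.functionField r) ≤ exp (-(n : ℤ)) ↔
      r ∈ IsLocalRing.maximalIdeal (X.presheaf.stalk x.1) ^ n := by
  have := isDiscreteValuationRing_stalk π x.2
  rw [closedPointValuation, IsDedekindDomain.HeightOneSpectrum.valuation_of_algebraMap]
  exact IsDedekindDomain.HeightOneSpectrum.intValuation_le_pow_iff_mem _ _ _

theorem closedPointValuation_generator {ϖ : X.presheaf.stalk x.1}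
    (hϖ : IsLocalRing.maximalIdeal (X.presheaf.stalk x.1) = Ideal.span {ϖ}) :
    closedPointValuation π x (algebraMap _ X.functionField ϖ) = exp (-1) := by
  have := isDiscreteValuationRing_stalk π x.2
  rw [closedPointValuation, IsDedekindDomain.HeightOneSpectrum.valuation_of_algebraMap]
  refine IsDedekindDomain.HeightOneSpectrum.intValuation_singleton _ ?_ hϖ
  rintro rfl
  exact IsDiscreteValuationRing.not_a_field (X.presheaf.stalk x.1) (by simpa using hϖ)

theorem closedPointValuation_eq_one_iff (r : X.presheaf.stalk x.1) :
    closedPointValuation π x (algebraMap _ X.functionField r) = 1 ↔ IsUnit r := by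
  rw [← not_iff_not, ← mem_nonunits_iff, ← IsLocalRing.mem_maximalIdeal,
    ← closedPointValuation_lt_one_iff π, lt_iff_le_and_ne, closedPointValuation_le_one_iff]
  exact (and_iff_right ⟨r, rfl⟩).symm

theorem hasOrder_iff (a : X.functionField) (n : ℤ) :
    HasOrder x.1 a n ↔ closedPointValuation π x a = exp (-n) := by
  have := isDiscreteValuationRing_stalk π x.2
  constructor
  · rintro ⟨ϖ, r, hϖ, hr, rfl⟩
    rw [map_mul, map_zpow₀, closedPointValuation_generator π x hϖ,
      (closedPointValuation_eq_one_iff π x r).2 hr, one_mul, ← exp_zsmul]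
    simp
  · intro ha
    obtain ⟨ϖ, hϖ⟩ := IsDiscreteValuationRing.exists_irreducible (X.presheaf.stalk x.1)
    have hm := hϖ.maximalIdeal_eq
    have hϖ1 := closedPointValuation_generator π x hm
    have hϖ0 : algebraMap _ X.functionField ϖ ≠ 0 := by
      intro h0
      rw [h0, map_zero] at hϖ1
      exact exp_ne_zero hϖ1.symm
    have h1 : closedPointValuation π x (a / algebraMap _ X.functionField ϖ ^ n) = 1 := by
      rw [map_div₀, map_zpow₀, hϖ1, ha, ← exp_zsmul]
      simp
    obtain ⟨r, hr⟩ := (closedPointValuation_le_one_iff π x _).1 h1.le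
    refine ⟨ϖ, r, hm, (closedPointValuation_eq_one_iff π x r).1 (hr ▸ h1), ?_⟩
    rw [hr, div_mul_cancel₀ _ (zpow_ne_zero _ hϖ0)]

theorem mem_localRingAtImage_iff (f a : X.functionField) :
    letI := functionFieldAlgebra π
    a ∈ localRingAtImage π f x.1 ↔ a ∈ k⟮f⟯ ∧ closedPointValuation π x a ≤ 1 := by
  rw [closedPointValuation_le_one_iff]
  exact Iff.rfl

theorem mem_nonunits_localRingAtImage_iff (f : X.functionField) (a : localRingAtImage π f x.1) :
    a ∈ nonunits (localRingAtImage π f x.1) ↔ closedPointValuation π x a < 1 := by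
  let := functionFieldAlgebra π
  obtain ⟨ha, ha1⟩ := (mem_localRingAtImage_iff π x f a).1 a.2
  rw [mem_nonunits_iff, lt_iff_le_and_ne, and_iff_right ha1, not_iff_not]
  constructor
  · intro hu
    obtain ⟨b, hb⟩ := hu.exists_right_inv
    obtain ⟨-, hb1⟩ := (mem_localRingAtImage_iff π x f b).1 b.2
    have h := congrArg (fun c : localRingAtImage π f x.1 => closedPointValuation π x c) hb
    simp only [Subring.coe_mul, map_mul, Subring.coe_one, map_one] at h
    refine le_antisymm ha1 ?_
    rw [← h]
    exact mul_le_of_le_one_right' hb1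
  · intro h1
    have ha0 : (a : X.functionField) ≠ 0 := by
      intro h0
      rw [h0, map_zero] at h1
      exact zero_ne_one h1
    refine IsUnit.of_mul_eq_one ⟨(a : X.functionField)⁻¹, (mem_localRingAtImage_iff π x f _).2
      ⟨inv_mem ha, by rw [map_inv₀, h1, inv_one]⟩⟩ (Subtype.ext ?_)
    exact mul_inv_cancel₀ ha0

theorem isUniformizerAtImage_iff (f t : X.functionField) :
    letI := functionFieldAlgebra π
    IsUniformizerAtImage π f x.1 t ↔ IsGeneratorAt k (closedPointValuation π x) f t := by
  let := functionFieldAlgebra π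
  constructor
  · rintro ⟨ht, h⟩
    have ht1 := (mem_nonunits_localRingAtImage_iff π x f _).1 ((h ⟨t, ht⟩).2 dvd_rfl)
    refine ⟨((mem_localRingAtImage_iff π x f t).1 ht).1, ht1, fun s hs hs1 => ?_⟩
    obtain ⟨c, hc⟩ := (h ⟨s, (mem_localRingAtImage_iff π x f s).2 ⟨hs, hs1.le⟩⟩).1
      ((mem_nonunits_localRingAtImage_iff π x f _).2 hs1)
    have hsc : s = t * c := congrArg Subtype.val hc
    rw [hsc, map_mul]
    exact mul_le_of_le_one_right' ((mem_localRingAtImage_iff π x f c).1 c.2).2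
  · rintro ⟨ht, ht1, hmax⟩
    refine ⟨(mem_localRingAtImage_iff π x f t).2 ⟨ht, ht1.le⟩, fun a => ?_⟩
    obtain ⟨ha, ha1⟩ := (mem_localRingAtImage_iff π x f a).1 a.2
    rw [mem_nonunits_localRingAtImage_iff]
    constructor
    · intro hlt
      have hle := hmax a ha hlt
      rcases eq_or_ne t 0 with rfl | ht0
      · have ha0 : (a : X.functionField) = 0 := by simpa using hle
        exact ⟨0, Subtype.ext (by simpa using ha0)⟩
      refine ⟨⟨a / t, (mem_localRingAtImage_iff π x f _).2 ⟨div_mem ha ht, ?_⟩⟩,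
        Subtype.ext (mul_div_cancel₀ _ ht0).symm⟩
      rw [map_div₀]
      exact div_le_one_of_le₀ hle zero_le
    · rintro ⟨c, rfl⟩
      rw [Subring.coe_mul, map_mul]
      exact (mul_le_of_le_one_right' ((mem_localRingAtImage_iff π x f c).1 c.2).2).trans_lt ht1

/-- The ideal in question is generated by t, hence equals the n-th power of the maximal ideal. These
powers strictly decrease, so the exponent is unique. -/
theorem hasRamificationIndex_iff {f t : X.functionField} {n : ℕ}
    (ht : letI := functionFieldAlgebra π; IsGeneratorAt k (closedPointValuation π x) f t)
    (hn : closedPointValuation π x t = exp (-(n : ℤ))) (e : ℕ) :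
    HasRamificationIndex π f x.1 e ↔ e = n := by
  let := functionFieldAlgebra π
  have := isDiscreteValuationRing_stalk π x.2
  have hspan : Ideal.span {s : X.presheaf.stalk x.1 | ∃ a : localRingAtImage π f x.1,
      a ∈ nonunits (localRingAtImage π f x.1) ∧ algebraMap _ X.functionField s = a} =
      IsLocalRing.maximalIdeal (X.presheaf.stalk x.1) ^ n := by
    refine le_antisymm (Ideal.span_le.2 ?_) fun r hr => ?_
    · rintro s ⟨a, ha, hs⟩
      rw [SetLike.mem_coe, ← closedPointValuation_le_exp_iff π, hs, ← hn]
      exact ht.2.2 _ ((mem_localRingAtImage_iff π x f a).1 a.2).1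
        ((mem_nonunits_localRingAtImage_iff π x f a).1 ha)
    · obtain ⟨s, hs⟩ := (closedPointValuation_le_one_iff π x t).1 ht.2.1.le
      have ht0 : t ≠ 0 := by
        rintro rfl
        rw [map_zero] at hn
        exact exp_ne_zero hn.symm
      rw [← closedPointValuation_le_exp_iff π, ← hn] at hr
      obtain ⟨c, hc⟩ := (closedPointValuation_le_one_iff π x
        (algebraMap _ X.functionField r / t)).1 (by
          rw [map_div₀]
          exact div_le_one_of_le₀ hr zero_le)
      have hrc : r = c * s := by
        apply IsFractionRing.injective (X.presheaf.stalk x.1) X.functionField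
        rw [map_mul, hc, hs, div_mul_cancel₀ _ ht0]
      rw [hrc]
      refine Ideal.mul_mem_left _ _ (Ideal.subset_span ⟨⟨t, (mem_localRingAtImage_iff π x f t).2
        ⟨ht.1, ht.2.1.le⟩⟩, (mem_nonunits_localRingAtImage_iff π x f _).2 ht.2.1, hs⟩)
  rw [HasRamificationIndex, hspan, eq_comm]
  exact (Ideal.pow_right_strictAnti _ (IsDiscreteValuationRing.not_a_field _)
    (Ideal.IsPrime.ne_top')).injective.eq_iff

theorem isTame_of_tameAt {f : X.functionField}
    (h : letI := functionFieldAlgebra π; ∀ x, TameAt k (closedPointValuation π x) f) :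
    IsTame π f := by
  let := functionFieldAlgebra π
  intro x hx
  obtain ⟨e, he, ⟨t, ht, hte⟩, hmax⟩ := h ⟨x, hx⟩
  have hgen : IsGeneratorAt k (closedPointValuation π ⟨x, hx⟩) f t := by
    refine ⟨ht, ?_, fun s hs hs1 => hte ▸ hmax s hs hs1⟩
    rw [hte, ← exp_zero, exp_lt_exp]
    have := he.pos
    omega
  exact ⟨e, (hasRamificationIndex_iff π ⟨x, hx⟩ hgen hte e).2 rfl, he.not_two_dvd_nat⟩

variable [CharP k 2] [PerfectField k]

/-- A uniformizer at the image has order equal to the ramification index, so adding 0⁴ suffices. -/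
theorem isPseudotame_of_isTame {f : X.functionField} (hf : f ∈ separableMorphisms π)
    (h : IsTame π f) : IsPseudotame π f := by
  let := functionFieldAlgebra π
  intro x hx
  obtain ⟨t, ht0, ht⟩ := (isPlace_closedPointValuation π ⟨x, hx⟩).exists_isGeneratorAt
    (transcendental_of_mem_separableMorphisms π hf)
  obtain ⟨e, he, hodd⟩ := h x hx
  obtain ⟨n, hn⟩ : ∃ n : ℕ, closedPointValuation π ⟨x, hx⟩ t = exp (-(n : ℤ)) := by
    have hv0 : closedPointValuation π ⟨x, hx⟩ t ≠ 0 := by simpa using ht0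
    have hlt := ht.2.1
    rw [← exp_log hv0, ← exp_zero, exp_lt_exp] at hlt
    exact ⟨(-log (closedPointValuation π ⟨x, hx⟩ t)).toNat, by
      rw [Int.toNat_of_nonneg (by omega), neg_neg, exp_log hv0]⟩
  obtain rfl := (hasRamificationIndex_iff π ⟨x, hx⟩ ht hn e).1 he
  refine ⟨t, (isUniformizerAtImage_iff π ⟨x, hx⟩ f t).2 ht, 0, e, ?_, ?_⟩
  · rw [hasOrder_iff π ⟨x, hx⟩]
    simpa using hn
  · exact_mod_cast Nat.not_even_iff_odd.1 fun h => hodd h.two_dvd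

theorem exists_not_isSquare_of_isPseudotame {f : X.functionField} (hf : f ∈ separableMorphisms π)
    (h : IsPseudotame π f) : ∃ g, ¬ IsSquare (closedPointValuation π x (f + g ^ 4)) := by
  let := functionFieldAlgebra π
  have : CharP X.functionField 2 :=
    charP_of_injective_algebraMap (algebraMap k X.functionField).injective 2
  obtain ⟨t, ht, g, n, hn, hodd⟩ := h x.1 x.2
  obtain ⟨htm, ht1, hmax⟩ := (isUniformizerAtImage_iff π x f t).1 ht
  refine (isPlace_closedPointValuation π x).exists_not_isSquare_add_pow_four
    (transcendental_of_mem_separableMorphisms π hf) htm ht1 hmax (h := g) ?_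
  rw [(hasOrder_iff π x _ _).1 hn, isSquare_exp_iff, even_neg, Int.not_even_iff_odd]
  exact hodd

end

/-! ### The transform stays in the orbit and stays separable -/

theorem pow_three_add_mem_gammaOrbit {K : Type u} [Field K] [CharP K 2] {f h : K}
    (hne : f + h ^ 4 ≠ 0) (d : K) : (f + h ^ 4) ^ 3 + d ^ 4 ∈ gammaOrbit f := by
  -- With F = f + h⁴, the numerator F⁴ + d⁴F equals d⁴f + (dh + F)⁴, and the determinant is -F.
  refine ⟨.mkOfDetNeZero !![d, d * h + (f + h ^ 4); 1, h] ?_, ?_⟩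
  · rw [Matrix.det_fin_two_of]
    rwa [mul_one, sub_add_cancel_left, neg_ne_zero]
  · change _ = (d ^ 4 * f + (d * h + (f + h ^ 4)) ^ 4) / (1 ^ 4 * f + h ^ 4)
    rw [one_pow, one_mul, add_pow_four, eq_div_iff hne]
    ring

theorem derivation_pow_four {k K M : Type*} [CommRing k] [CommRing K] [CharP K 2] [Algebra k K]
    [AddCommGroup M] [Module K M] [Module k M] (D : Derivation k K M) (a : K) : D (a ^ 4) = 0 := by
  rw [D.leibniz_pow, ← Nat.cast_smul_eq_nsmul K, show ((4 : ℕ) : K) = 0 from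
    (CharP.cast_eq_zero_iff K 2 4).2 (by norm_num), zero_smul]

noncomputable section

variable {k : Type u} [Field k] {X : Scheme.{u}} [IsIntegral X] (π : X ⟶ Spec (.of k))
  [CharP k 2]

/-- Fourth powers have zero differential and 3 = 1, so the differential of the transform is (f +
h⁴)²·df. -/
theorem pow_three_add_mem_separableMorphisms {f h : X.functionField}
    (hf : f ∈ separableMorphisms π) (hne : f + h ^ 4 ≠ 0) (d : X.functionField) :
    (f + h ^ 4) ^ 3 + d ^ 4 ∈ separableMorphisms π := by
  let := functionFieldAlgebra π
  have : CharP X.functionField 2 :=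
    charP_of_injective_algebraMap (algebraMap k X.functionField).injective 2
  let D := KaehlerDifferential.D k X.functionField
  have hD : D ((f + h ^ 4) ^ 3 + d ^ 4) = (f + h ^ 4) ^ 2 • D f := by
    rw [map_add, derivation_pow_four, add_zero, D.leibniz_pow, map_add, derivation_pow_four,
      add_zero, ← Nat.cast_smul_eq_nsmul X.functionField, show ((3 : ℕ) : X.functionField) = 1 by
        push_cast
        linear_combination CharTwo.two_eq_zero (R := X.functionField), one_smul]
  change D _ ≠ 0
  rw [hD]
  exact smul_ne_zero (pow_ne_zero 2 hne) hf

end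

end PseudotameCurve

theorem lemma5p4 {k : Type u} [Field k] [CharP k 2] [PerfectField k]
    {X : Scheme.{u}} [IsIntegral X] (π : X ⟶ Spec (.of k))
    [SmoothOfRelativeDimension 1 π] [IsProper π] [GeometricallyIrreducible π] :
    (∀ f ∈ PseudotameCurve.separableMorphisms π, PseudotameCurve.IsPseudotame π f →
      ∃ g ∈ PseudotameCurve.gammaOrbit f,
        g ∈ PseudotameCurve.separableMorphisms π ∧ PseudotameCurve.IsTame π g) ∧
    ((∃ f ∈ PseudotameCurve.separableMorphisms π, PseudotameCurve.IsTame π f) ↔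
      ∃ f ∈ PseudotameCurve.separableMorphisms π, PseudotameCurve.IsPseudotame π f) := by
  open PseudotameCurve in
  have main : ∀ f ∈ separableMorphisms π, IsPseudotame π f →
      ∃ g ∈ gammaOrbit f, g ∈ separableMorphisms π ∧ IsTame π g := by
    intro f hf hpt
    let := functionFieldAlgebra π
    have : CharP X.functionField 2 :=
      charP_of_injective_algebraMap (algebraMap k X.functionField).injective 2
    have : CompactSpace X := QuasiCompact.compactSpace_of_compactSpace π
    have htr := transcendental_of_mem_separableMorphisms π hf
    obtain ⟨h, d, hhd⟩ := (isCurve_closedPointValuation π).exists_tame htr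
      (finiteDimensional_of_mem_separableMorphisms π hf)
      (fun x => exists_not_isSquare_of_isPseudotame π x hf hpt) (finite_not_unramifiedAt π hf)
    have hne : f + h ^ 4 ≠ 0 := by
      intro h0
      refine hf ?_
      rw [eq_neg_of_add_eq_zero_left h0, map_neg, derivation_pow_four, neg_zero]
    exact ⟨_, pow_three_add_mem_gammaOrbit hne d,
      pow_three_add_mem_separableMorphisms π hf hne d, isTame_of_tameAt π hhd⟩
  exact ⟨main, fun ⟨f, hf, ht⟩ => ⟨f, hf, PseudotameCurve.isPseudotame_of_isTame π hf ht⟩,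
    fun ⟨f, hf, hpt⟩ => (main f hf hpt).imp fun _ hg => hg.2⟩
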